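/- **Setup.** Let $x_1,\dots,x_n$ be $n$ points with a metric $d$, let $\lambda\in\mathbb R$, and let $w_1,\dots,w_n\in(0,1/2]$ be $\lambda$-compatible weights, i.e. $d(x_i,x_j)/w_j\le\lambda\sum_{k=1}^n d(x_i,x_k)$ for all $i,j$. Let $\varepsilon>0$, $\gamma\ge 1$, $t_e,t_0\in\mathbb N$ satisfy $$t_e\ge\frac{n\lambda}{\varepsilon},\qquad \gamma\ge\frac{(\ln t_e+1)^2\lambda}{\varepsilon^2},\qquad t_0\ge\max\Big\{\frac{\sqrt{\gamma\lambda}}{\varepsilon},\frac1\varepsilon\Big\}.$$ *Timelines and masks.* The activation timeline $\mathcal T(w)$ is the law of $a\in\{0,1\}^{t_e}$ drawn sequentially for $t=1,\dots,t_e$ by $a_t\sim\mathrm{Ber}(w^t)$, where $w^t=\min\{w,1/t\}$ if $a_\ell=0$ for all $\ell<t$, and $w^t=w$ otherwise; the smallest $t$ with $a_t=1$ is its activation time. The mask $\mathcal K(t_0,\gamma)$ is the law of $k\in\{0,1\}^{t_e}$ with independent $k_t\sim\mathrm{Ber}(\gamma^t)$, where $\gamma^t=1$ for $t\le t_0$ and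 $\gamma^t=\min\{\gamma/t,1\}$ for $t>t_0$. Draw $n\times t_e$ matrices $A,K$ with mutually independent rows $A_i\sim\mathcal T(w_i)$, $K_i\sim\mathcal K(t_0,\gamma)$. Let $t_i$ be the activation time of $A_i$ (if there is one) and let $w_j^\ell$ be the parameter with which $A_{j,\ell}$ was drawn, so $w_j^\ell=\min\{w_j,1/\ell\}$ for $\ell\le t_j$ (or for all $\ell$ if $A_j$ never activates) and $w_j^\ell=w_j$ for $\ell>t_j$. *Seeds and assignment.* Let $S^{t_0}=\{j:\exists\,\ell\le t_0,\ A_{j,\ell}=1\}$ and $m=|S^{t_0}|$. A seed is a string $\sigma\in\{0,1\}^m$; its entries are matched with the points of $S^{t_0}$ in increasing order of their index. Given $\sigma$, the cut $z(\sigma)\in\{0,1\}^{n\times\{0,1\}}$ has rows $(1,0)$ (the $0$-side) or $(0,1)$ (the $1$-side), defined as follows. - If $t_i\le t_0$, then $x_i$ is put on the side given by the entry of $\sigma$ matched with it. - If $t_i>t_0$, then, recursively in the activation time, let $$C_b=\sum_{\substack{(j,\ell):\ \ell<t_i\\ A_{j,\ell}K_{j,\ell}=1}}\frac{d(x_i,x_j)}{w_j^\ell\,\gamma^\ell}\,z(\sigma)_{j,b}\qquad(b=0,1),$$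 and put $x_i$ on the $1$-side if $C_0>C_1$ and on the $0$-side otherwise. - If $A_i$ never activates, $x_i$ is put on the $0$-side. For $z\in\{0,1\}^{n\times\{0,1\}}$ let $f(z)=\frac12\sum_{i=1}^n\sum_{j=1}^n d(x_i,x_j)\,(z_{i,0}z_{j,0}+z_{i,1}z_{j,1})$. **Theorem.** There is a universal constant $C>0$ such that, in every such setup, $$\mathbb E_{A,K}\Big[\min_{\sigma\in\{0,1\}^m} f(z(\sigma))\Big]\ \le\ \min_{\substack{z\in\{0,1\}^{n\times\{0,1\}}\\ z_i\ne(0,0)\ \forall i}} f(z)\;+\;C\,\varepsilon\sum_{i=1}^n\sum_{j=1}^n d(x_i,x_j).$$ -/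

import Mathlib

noncomputable section

namespace ParallelGreedy

/-! ### Sampling of timelines and masks

A string in `{0,1}^T` is a function `Fin T → Bool`. Times run through `1, …, T`; the
index `ℓ : Fin T` stands for the time `ℓ + 1`. -/

/-- The time `ℓ + 1 ∈ {1, …, T}` for which the index `ℓ : Fin T` stands. -/
def time {T : ℕ} (ℓ : Fin T) : ℕ := (ℓ : ℕ) + 1

/-- The mass that the Bernoulli distribution `Ber(p)` gives to the bit `b`. -/
def berProb (p : ℝ) (b : Bool) : ℝ := if b = true then p else 1 - p

/-- The activation probability `w^t` at the time `t` for a timeline `a` of a point of weight `w`: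
it is `min {w, 1/t}` if `a` has no activation strictly before `t`, and `w` otherwise. -/
def actWeight {T : ℕ} (w : ℝ) (a : Fin T → Bool) (ℓ : Fin T) : ℝ :=
  if ∀ s : Fin T, s < ℓ → a s = false then min w (1 / (time ℓ : ℝ)) else w

/-- The probability of the string `a` under the activation timeline distribution `𝒯(w)`: the bit at
each time `t = 1, …, T` is drawn from `Ber(w^t)`, where `w^t` depends on the bits before `t`. -/
def timelineProb {T : ℕ} (w : ℝ) (a : Fin T → Bool) : ℝ :=
  ∏ ℓ, berProb (actWeight w a ℓ) (a ℓ)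

/-- The keeping probability `γ^t`: it is `1` for `t ≤ t₀` and `min {γ/t, 1}` for `t > t₀`. -/
def keepProb (t₀ : ℕ) (γ : ℝ) (t : ℕ) : ℝ := if t ≤ t₀ then 1 else min (γ / (t : ℝ)) 1

/-- The probability of the string `k` under the mask distribution `𝒦(t₀, γ)`: the bits are
independent, the one at the time `t` is drawn from `Ber(γ^t)`. -/
def maskProb {T : ℕ} (t₀ : ℕ) (γ : ℝ) (k : Fin T → Bool) : ℝ :=
  ∏ ℓ, berProb (keepProb t₀ γ (time ℓ)) (k ℓ)

/-- The expectation of `Y (A, K)` for random `n × T` matrices `A`, `K` with mutually independent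
rows `A i ~ 𝒯(w i)` and `K i ~ 𝒦(t₀, γ)`, `i = 1, …, n`. -/
def expect {n T : ℕ} (w : Fin n → ℝ) (t₀ : ℕ) (γ : ℝ)
    (Y : (Fin n → Fin T → Bool) → (Fin n → Fin T → Bool) → ℝ) : ℝ :=
  ∑ A : Fin n → Fin T → Bool, ∑ K : Fin n → Fin T → Bool,
    ((∏ i, timelineProb (w i) (A i)) * ∏ i, maskProb t₀ γ (K i)) * Y A K

/-! ### Metric-compatible weights -/

/-- The weights `w` are `lam`-compatible with the points `x`:
`d(xᵢ, xⱼ) / wⱼ ≤ lam · ∑ₖ d(xᵢ, xₖ)` for all `i, j`. -/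
def Compatible {X : Type*} [MetricSpace X] {n : ℕ} (x : Fin n → X) (w : Fin n → ℝ)
    (lam : ℝ) : Prop :=
  ∀ i j : Fin n, dist (x i) (x j) / w j ≤ lam * ∑ k, dist (x i) (x k)

/-! ### Cuts -/

/-- A 0/1 matrix with rows indexed by the points and columns by the sides `0, 1`: a partial cut.
The row of a point is `(0,0)` if the point is unassigned, `(1,0)` if it is on the `0`-side, and
`(0,1)` if it is on the `1`-side. -/
abbrev Cut (n : ℕ) : Type := Fin n → Fin 2 → Bool

/-- The row `(1,0)` for `b = 0`, and `(0,1)` for `b = 1`. -/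
def sideRow (b : Fin 2) : Fin 2 → Bool := fun c => decide (c = b)

/-- The entry of a 0/1 matrix as a real number. -/
def bit (b : Bool) : ℝ := if b = true then 1 else 0

/-- The sum of internal distances
`f(z) = ½ ∑ᵢ ∑ⱼ d(xᵢ, xⱼ) (z_{i,0} z_{j,0} + z_{i,1} z_{j,1})`. -/
def internal {X : Type*} [MetricSpace X] {n : ℕ} (x : Fin n → X) (z : Cut n) : ℝ :=
  (1 / 2 : ℝ) * ∑ i, ∑ j, dist (x i) (x j) *
    (bit (z i 0) * bit (z j 0) + bit (z i 1) * bit (z j 1))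

/-- The 0/1 matrices none of whose rows is `(0,0)`. -/
abbrev FullCut (n : ℕ) : Type := {z : Cut n // ∀ i, z i ≠ fun _ => false}

/-! ### Activation times, summary and seeds -/

/-- The activation time of a timeline that activates at all: the smallest `t` with `a_t = 1`. -/
def actTime {T : ℕ} (a : Fin T → Bool) (h : ∃ ℓ, a ℓ = true) : ℕ :=
  time ((Finset.univ.filter fun ℓ => a ℓ = true).min' (by
    obtain ⟨ℓ, hℓ⟩ := h
    exact ⟨ℓ, by simpa using hℓ⟩))

theorem actTime_le {T : ℕ} {a : Fin T → Bool} {ℓ : Fin T} (hℓ : a ℓ = true) :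
    actTime a ⟨ℓ, hℓ⟩ ≤ time ℓ := by
  unfold actTime time
  have := Finset.min'_le (Finset.univ.filter fun ℓ => a ℓ = true) ℓ (by simpa using hℓ)
  exact Nat.succ_le_succ this

theorem exists_time_eq_actTime {T : ℕ} (a : Fin T → Bool) (h : ∃ ℓ, a ℓ = true) :
    ∃ ℓ, time ℓ = actTime a h ∧ a ℓ = true := by
  refine ⟨_, rfl, ?_⟩
  have := Finset.min'_mem (Finset.univ.filter fun ℓ => a ℓ = true) (by
    obtain ⟨ℓ, hℓ⟩ := h
    exact ⟨ℓ, by simpa using hℓ⟩)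
  simpa using this

/-- The timeline-mask summary: the pairs (point, time) that are activated and kept. (The weight and
the activation time of the point, which the summary records too, are determined by the point.) -/
def summary {n T : ℕ} (A K : Fin n → Fin T → Bool) : Finset (Fin n × Fin T) :=
  Finset.univ.filter fun p => A p.1 p.2 = true ∧ K p.1 p.2 = true

/-- The set `S^{t₀}` of the points that are activated at some time `ℓ ≤ t₀`. -/
def seedSet {n T : ℕ} (A : Fin n → Fin T → Bool) (t₀ : ℕ) : Finset (Fin n) :=
  Finset.univ.filter fun j => ∃ ℓ : Fin T, time ℓ ≤ t₀ ∧ A j ℓ = true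

/-- The seeds: the strings `σ ∈ {0,1}^m` of length `m = |S^{t₀}|`. -/
abbrev Seed {n T : ℕ} (A : Fin n → Fin T → Bool) (t₀ : ℕ) : Type :=
  Fin (seedSet A t₀).card → Fin 2

/-- The position `π(xᵢ)` of the point `i` in the ordered list of the points of `S^{t₀}`. -/
def seedIndex {n T : ℕ} (A : Fin n → Fin T → Bool) (t₀ : ℕ) (i : Fin n)
    (hi : i ∈ seedSet A t₀) : Fin (seedSet A t₀).card :=
  ((seedSet A t₀).orderIsoOfFin rfl).symm ⟨i, hi⟩

theorem mem_seedSet {n T : ℕ} {A : Fin n → Fin T → Bool} {t₀ : ℕ} {i : Fin n}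
    {h : ∃ ℓ, A i ℓ = true} (ht : actTime (A i) h ≤ t₀) : i ∈ seedSet A t₀ := by
  obtain ⟨ℓ, h1, h2⟩ := exists_time_eq_actTime (A i) h
  simp only [seedSet, Finset.mem_filter, Finset.mem_univ, true_and]
  exact ⟨ℓ, h1 ▸ ht, h2⟩

/-! ### The assignment rule -/

/-- The assignment rule `Assign_σ(xᵢ, tᵢ)` for a point `i` with activation time `tᵢ`.

If `tᵢ ≤ t₀`, the point goes to the side that the seed prescribes. Otherwise the estimates
`C_b = ∑ d(xᵢ, xⱼ) / (wⱼ^ℓ γ^ℓ) · z_{j,b}` are formed, where the sum runs over the pairs `(j, ℓ)` of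
the summary with `ℓ < tᵢ`, and `z_j` is the (recursively computed) assignment of `j`; the point goes
to the `1`-side if `C₀ > C₁`, and to the `0`-side otherwise. -/
def assign {X : Type*} [MetricSpace X] {n T : ℕ} (x : Fin n → X) (w : Fin n → ℝ) (t₀ : ℕ) (γ : ℝ)
    (A K : Fin n → Fin T → Bool) (σ : Seed A t₀) (i : Fin n) (h : ∃ ℓ, A i ℓ = true) :
    Fin 2 → Bool :=
  if ht : actTime (A i) h ≤ t₀ then
    sideRow (σ (seedIndex A t₀ i (mem_seedSet ht)))
  else
    let C : Fin 2 → ℝ := fun b => ∑ p : Fin n × Fin T,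
      if hp : p ∈ summary A K ∧ time p.2 < actTime (A i) h then
        dist (x i) (x p.1) / (actWeight (w p.1) (A p.1) p.2 * keepProb t₀ γ (time p.2)) *
          bit (assign x w t₀ γ A K σ p.1 ⟨p.2, (Finset.mem_filter.1 hp.1).2.1⟩ b)
      else 0
    if C 0 > C 1 then sideRow 1 else sideRow 0
termination_by actTime (A i) h
decreasing_by exact lt_of_le_of_lt (actTime_le (Finset.mem_filter.1 hp.1).2.1) hp.2

/-- The cut `z(σ)`: activated points are assigned by the assignment rule, and points that are never
activated are put on the `0`-side. -/
def outputCut {X : Type*} [MetricSpace X] {n T : ℕ} (x : Fin n → X) (w : Fin n → ℝ) (t₀ : ℕ)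
    (γ : ℝ) (A K : Fin n → Fin T → Bool) (σ : Seed A t₀) : Cut n :=
  fun i => if h : ∃ ℓ, A i ℓ = true then assign x w t₀ γ A K σ i h else sideRow 0

/-- The smallest value of a real function on a non-empty finite type. -/
def minValue {ι : Type*} [Fintype ι] [Nonempty ι] (g : ι → ℝ) : ℝ :=
  Finset.univ.inf' Finset.univ_nonempty g

instance (n : ℕ) : Nonempty (FullCut n) :=
  ⟨⟨fun _ _ => true, fun _ h => by simpa using congrFun h 0⟩⟩

end ParallelGreedy

end

/-! Fix a cut `s` contained in a competing 0/1 matrix. Since the minimum over seeds sits inside the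
expectation, it is at most the cost of the seed that copies `s` on the sampled points, so it
suffices to bound the expected cost of that one run.

The run is compared with a fractional cut `frac`, which equals `s` up to time `t₀` and is frozen on
activated points, where it is the side actually assigned (`bit_assign_eq_frac`). A point that is
still inactive moves by `mix`, chosen so that two things hold at once: the deviation `(load - T) *
frac` is a martingale (`sum_stepProb_nextDev`), and the conditional mean of the row moves by
`1/(T+1)` of the way towards the greedy choice (`sum_stepProb_nextFrac`). Rows are conditionally
independent and the diagonal distances vanish, so the quadratic cost changes in mean by a
first-order term plus `O(1/T²)` times the total distance. The greedy rule makes the first-order term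
nonpositive when measured with the estimates. These are `T` times the true distance sums plus the
martingale `noise`, hence the loss per step is at most about `E|noise| / T²`
(`expect_cost_succ_le`).

Compatibility bounds the second moment of the noise of the point `i` by `O(lam * D i ^ 2 * (T +
T²/γ))`. Summing over times from `t₀` on gives `√(lam/t₀) + √(lam/γ) log T + 1/t₀` up to constants,
and each term is `O(ε)` by the choice of parameters. Points that never activate cost a further `n *
lam / T ≤ ε` times the total distance. -/

namespace ParallelGreedy

/-! ### Product distributions on finite types -/

section ProductDistribution

variable {ι β : Type*} [Fintype ι] [DecidableEq ι] [Fintype β]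

/-- The expectation of `F` under the product of the mass functions `μ i`. -/
def prodExp (μ : ι → β → ℝ) (F : (ι → β) → ℝ) : ℝ := ∑ c, (∏ i, μ i (c i)) * F c

theorem prodExp_prod (μ φ : ι → β → ℝ) :
    prodExp μ (fun c => ∏ i, φ i (c i)) = ∏ i, ∑ b, μ i b * φ i b := by
  simp [prodExp, Finset.prod_univ_sum, ← Finset.prod_mul_distrib]

theorem prodExp_sum {κ : Type*} (μ : ι → β → ℝ) (s : Finset κ) (F : κ → (ι → β) → ℝ) :
    prodExp μ (fun c => ∑ k ∈ s, F k c) = ∑ k ∈ s, prodExp μ (F k) := by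
  simp only [prodExp, Finset.mul_sum]
  exact Finset.sum_comm

theorem prodExp_const_mul (μ : ι → β → ℝ) (a : ℝ) (F : (ι → β) → ℝ) :
    prodExp μ (fun c => a * F c) = a * prodExp μ F := by
  simp only [prodExp, Finset.mul_sum]
  exact Finset.sum_congr rfl fun c _ => by ring

variable {μ : ι → β → ℝ} (hμ : ∀ i, ∑ b, μ i b = 1)

include hμ in
theorem prodExp_const (a : ℝ) : prodExp μ (fun _ => a) = a := by
  have h := prodExp_prod μ (fun _ _ => 1)
  simp only [Finset.prod_const_one, mul_one, hμ] at h
  have h2 := prodExp_const_mul μ a (fun _ => 1)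
  simpa [h] using h2

include hμ in
theorem prodExp_coord (i : ι) (φ : β → ℝ) :
    prodExp μ (fun c => φ (c i)) = ∑ b, μ i b * φ b := by
  have h := prodExp_prod μ (fun k b => if k = i then φ b else 1)
  rw [Finset.prod_eq_single (M := ℝ) i] at h
  · simpa using h
  · intro k _ hk
    simp [hk, hμ]
  · simp

include hμ in
theorem prodExp_coord_mul {i j : ι} (hij : i ≠ j) (φ ψ : β → ℝ) :
    prodExp μ (fun c => φ (c i) * ψ (c j)) = (∑ b, μ i b * φ b) * ∑ b, μ j b * ψ b := by
  have h := prodExp_prod μ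
    (fun k b => (if k = i then φ b else 1) * (if k = j then ψ b else 1))
  simp only [Finset.prod_mul_distrib, Finset.prod_ite_eq', Finset.mem_univ, if_true] at h
  rw [h, Finset.prod_eq_mul (M := ℝ) i j hij]
  · simp [hij, hij.symm]
  · intro k _ hk
    simp [hk.1, hk.2, hμ]
  · simp
  · simp

-- The coordinates are independent, so cross terms factor and only the individual variances are
-- added to the square of the mean.
include hμ in
theorem prodExp_sq_sum (Y : ι → β → ℝ) (m : ι → ℝ) (hm : ∀ i, ∑ b, μ i b * Y i b = m i) :
    prodExp μ (fun c => (∑ i, Y i (c i)) ^ 2) =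
      (∑ i, m i) ^ 2 + ∑ i, ∑ b, μ i b * (Y i b - m i) ^ 2 := by
  have key : ∀ i j, prodExp μ (fun c => Y i (c i) * Y j (c j)) =
      m i * m j + if j = i then ∑ b, μ i b * (Y i b - m i) ^ 2 else 0 := by
    intro i j
    by_cases h : j = i
    · subst h
      rw [if_pos rfl, prodExp_coord hμ j (fun b => Y j b * Y j b)]
      have : ∑ b, μ j b * (Y j b - m j) ^ 2 =
          ∑ b, μ j b * (Y j b * Y j b) - 2 * m j * ∑ b, μ j b * Y j b
            + m j ^ 2 * ∑ b, μ j b := by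
        rw [Finset.mul_sum, Finset.mul_sum, ← Finset.sum_sub_distrib, ← Finset.sum_add_distrib]
        exact Finset.sum_congr rfl fun b _ => by ring
      rw [this, hm, hμ]
      ring
    · rw [if_neg h, prodExp_coord_mul hμ (Ne.symm h) (Y i) (Y j), hm, hm, add_zero]
  have hsq : ∀ c : ι → β, (∑ i, Y i (c i)) ^ 2 = ∑ i, ∑ j, Y i (c i) * Y j (c j) := fun c => by
    rw [sq, Finset.sum_mul_sum]
  simp only [hsq, prodExp_sum, key, Finset.sum_add_distrib, Finset.sum_ite_eq', Finset.mem_univ,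
    if_true]
  rw [sq, Finset.sum_mul_sum]

end ProductDistribution

/-! ### Extending histories by one column -/

section Extend

variable {n T : ℕ}

/-- The history `A` of length `T`, followed by the column `α`. -/
def extend (A : Fin n → Fin T → Bool) (α : Fin n → Bool) : Fin n → Fin (T + 1) → Bool :=
  fun i => Fin.snoc (α := fun _ => Bool) (A i) (α i)

@[simp]
theorem extend_castSucc (A : Fin n → Fin T → Bool) (α : Fin n → Bool) (i : Fin n) (ℓ : Fin T) :
    extend A α i ℓ.castSucc = A i ℓ := by simp [extend]

@[simp]
theorem extend_last (A : Fin n → Fin T → Bool) (α : Fin n → Bool) (i : Fin n) :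
    extend A α i (Fin.last T) = α i := by simp [extend]

/-- Histories of length `T + 1` are histories of length `T` together with a column. -/
def extendEquiv (n T : ℕ) :
    (Fin n → Fin T → Bool) × (Fin n → Bool) ≃ (Fin n → Fin (T + 1) → Bool) where
  toFun p := extend p.1 p.2
  invFun A := (fun i ℓ => A i ℓ.castSucc, fun i => A i (Fin.last T))
  left_inv p := by simp
  right_inv A := by
    funext i ℓ
    refine Fin.lastCases ?_ (fun ℓ => ?_) ℓ <;> simp

theorem sum_extend (F : (Fin n → Fin (T + 1) → Bool) → ℝ) :
    ∑ A, F A = ∑ A : Fin n → Fin T → Bool, ∑ α : Fin n → Bool, F (extend A α) := by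
  rw [← (extendEquiv n T).sum_comp, Fintype.sum_prod_type]
  rfl

/-- The activation probability at time `T + 1` after the history `a` of length `T`. -/
noncomputable def nextWeight (w : ℝ) (a : Fin T → Bool) : ℝ :=
  if ∀ s, a s = false then min w (1 / ((T : ℝ) + 1)) else w

theorem actWeight_extend_castSucc (v : ℝ) (A : Fin n → Fin T → Bool) (α : Fin n → Bool)
    (i : Fin n) (ℓ : Fin T) :
    actWeight v (extend A α i) ℓ.castSucc = actWeight v (A i) ℓ := by
  have : (∀ s : Fin (T + 1), s < ℓ.castSucc → extend A α i s = false) ↔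
      ∀ s : Fin T, s < ℓ → A i s = false := by
    simp [Fin.forall_fin_succ']
    intro _ h
    exact absurd h (by simp [Fin.lt_def])
  simp only [actWeight, this, time, Fin.val_castSucc]

theorem actWeight_extend_last (v : ℝ) (A : Fin n → Fin T → Bool) (α : Fin n → Bool)
    (i : Fin n) :
    actWeight v (extend A α i) (Fin.last T) = nextWeight v (A i) := by
  have : (∀ s : Fin (T + 1), s < Fin.last T → extend A α i s = false) ↔
      ∀ s : Fin T, A i s = false := by
    simp [Fin.forall_fin_succ', Fin.castSucc_lt_last]
  simp only [actWeight, nextWeight, this, time, Fin.val_last, Nat.cast_add, Nat.cast_one]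

/-- The conditional distribution of the entries of the row `i` at time `T + 1`, given the history
of length `T`. -/
noncomputable def stepProb (w : Fin n → ℝ) (t₀ : ℕ) (γ : ℝ) (A : Fin n → Fin T → Bool) (i : Fin n)
    (c : Bool × Bool) : ℝ :=
  berProb (nextWeight (w i) (A i)) c.1 * berProb (keepProb t₀ γ (T + 1)) c.2

theorem timelineProb_extend (v : ℝ) (A : Fin n → Fin T → Bool) (α : Fin n → Bool) (i : Fin n) :
    timelineProb v (extend A α i) = timelineProb v (A i) * berProb (nextWeight v (A i)) (α i) := by
  simp [timelineProb, Fin.prod_univ_castSucc, actWeight_extend_castSucc, actWeight_extend_last]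

theorem maskProb_extend (t₀ : ℕ) (γ : ℝ) (K : Fin n → Fin T → Bool) (κ : Fin n → Bool)
    (i : Fin n) :
    maskProb t₀ γ (extend K κ i) =
      maskProb t₀ γ (K i) * berProb (keepProb t₀ γ (T + 1)) (κ i) := by
  simp [maskProb, Fin.prod_univ_castSucc, time]

/-- The expectation over histories of length `T + 1` is obtained by first averaging over the last
column. -/
theorem expect_succ (w : Fin n → ℝ) (t₀ : ℕ) (γ : ℝ)
    (Y : (Fin n → Fin (T + 1) → Bool) → (Fin n → Fin (T + 1) → Bool) → ℝ) :
    expect w t₀ γ Y = expect w t₀ γ (fun A K => prodExp (stepProb w t₀ γ A)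
      (fun c => Y (extend A fun i => (c i).1) (extend K fun i => (c i).2))) := by
  unfold expect
  rw [sum_extend]
  refine Finset.sum_congr rfl fun A _ => ?_
  simp only [sum_extend]
  rw [Finset.sum_comm]
  refine Finset.sum_congr rfl fun K _ => ?_
  rw [prodExp, Finset.mul_sum, ← (Equiv.arrowProdEquivProdArrow (Fin n) (fun _ => Bool)
    (fun _ => Bool)).symm.sum_comp, Fintype.sum_prod_type]
  refine Finset.sum_congr rfl fun α _ => Finset.sum_congr rfl fun κ _ => ?_
  simp only [timelineProb_extend, maskProb_extend, stepProb, Finset.prod_mul_distrib,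
    Equiv.arrowProdEquivProdArrow_symm_apply]
  ring

end Extend

/-! ### Basic properties of the expectation -/

section Expect

variable {n T : ℕ} {w : Fin n → ℝ} {t₀ : ℕ} {γ : ℝ}

theorem berProb_nonneg {p : ℝ} (h0 : 0 ≤ p) (h1 : p ≤ 1) (b : Bool) : 0 ≤ berProb p b := by
  unfold berProb
  split_ifs <;> linarith

theorem keepProb_pos (hγ : 1 ≤ γ) (t : ℕ) : 0 < keepProb t₀ γ (t + 1) := by
  unfold keepProb
  split_ifs
  · exact one_pos
  · positivity

theorem keepProb_le_one (t : ℕ) : keepProb t₀ γ t ≤ 1 := by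
  unfold keepProb
  split_ifs
  · exact le_rfl
  · exact min_le_right _ _

/-- The inverse is the maximum of `1` and a ratio, or just `1`; bounding it by a sum avoids case
distinctions in the variance estimates. -/
theorem inv_keepProb_le (hγ : 1 ≤ γ) (t : ℕ) :
    (keepProb t₀ γ (t + 1))⁻¹ ≤ 1 + ((t : ℝ) + 1) / γ := by
  have h1 : (0 : ℝ) ≤ ((t : ℝ) + 1) / γ := by positivity
  unfold keepProb
  split_ifs
  · simpa using h1
  · rcases min_cases (γ / ((t + 1 : ℕ) : ℝ)) 1 with h | h <;> rw [h.1]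
    · rw [inv_div]
      push_cast
      linarith
    · simpa using h1

theorem nextWeight_pos {v : ℝ} (hv : 0 < v) (a : Fin T → Bool) : 0 < nextWeight v a := by
  unfold nextWeight
  split_ifs <;> positivity

theorem nextWeight_le {v : ℝ} (a : Fin T → Bool) : nextWeight v a ≤ v := by
  unfold nextWeight
  split_ifs
  · exact min_le_left _ _
  · exact le_rfl

theorem actWeight_pos {v : ℝ} (hv : 0 < v) (a : Fin T → Bool) (ℓ : Fin T) :
    0 < actWeight v a ℓ := by
  unfold actWeight time
  split_ifs <;> positivity

theorem actWeight_le {v : ℝ} (a : Fin T → Bool) (ℓ : Fin T) : actWeight v a ℓ ≤ v := by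
  unfold actWeight
  split_ifs
  · exact min_le_left _ _
  · exact le_rfl

theorem sum_stepProb_mul (A : Fin n → Fin T → Bool) (i : Fin n) (φ : Bool × Bool → ℝ) :
    ∑ c, stepProb w t₀ γ A i c * φ c =
      nextWeight (w i) (A i) * (keepProb t₀ γ (T + 1) * φ (true, true) +
        (1 - keepProb t₀ γ (T + 1)) * φ (true, false)) +
      (1 - nextWeight (w i) (A i)) * (keepProb t₀ γ (T + 1) * φ (false, true) +
        (1 - keepProb t₀ γ (T + 1)) * φ (false, false)) := by
  simp [stepProb, Fintype.sum_prod_type, berProb]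
  ring

theorem sum_stepProb (A : Fin n → Fin T → Bool) (i : Fin n) :
    ∑ c, stepProb w t₀ γ A i c = 1 := by
  have := sum_stepProb_mul (w := w) (t₀ := t₀) (γ := γ) A i (fun _ => 1)
  simp only [mul_one] at this
  rw [this]
  ring

theorem expect_add (Y Z : (Fin n → Fin T → Bool) → (Fin n → Fin T → Bool) → ℝ) :
    expect w t₀ γ (fun A K => Y A K + Z A K) = expect w t₀ γ Y + expect w t₀ γ Z := by
  simp only [expect, mul_add, Finset.sum_add_distrib]

theorem expect_const_mul (a : ℝ) (Y : (Fin n → Fin T → Bool) → (Fin n → Fin T → Bool) → ℝ) :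
    expect w t₀ γ (fun A K => a * Y A K) = a * expect w t₀ γ Y := by
  simp only [expect, Finset.mul_sum]
  exact Finset.sum_congr rfl fun A _ => Finset.sum_congr rfl fun K _ => by ring

theorem expect_sum {κ : Type*} (s : Finset κ)
    (Y : κ → (Fin n → Fin T → Bool) → (Fin n → Fin T → Bool) → ℝ) :
    expect w t₀ γ (fun A K => ∑ k ∈ s, Y k A K) = ∑ k ∈ s, expect w t₀ γ (Y k) := by
  simp only [expect, Finset.mul_sum]
  exact (Finset.sum_congr rfl fun A _ => Finset.sum_comm).trans Finset.sum_comm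

theorem expect_const (a : ℝ) :
    expect w t₀ γ (fun (_ _ : Fin n → Fin T → Bool) => a) = a := by
  -- The activation law depends on the past, so total mass one is obtained by peeling off the last
  -- column.
  induction T with
  | zero => simp [expect, timelineProb, maskProb]
  | succ T ih =>
    rw [expect_succ]
    simp only [prodExp_const (sum_stepProb _)]
    exact ih

theorem expect_mono (hw : ∀ i, 0 < w i ∧ w i ≤ 1 / 2) (hγ : 1 ≤ γ)
    {Y Z : (Fin n → Fin T → Bool) → (Fin n → Fin T → Bool) → ℝ} (h : ∀ A K, Y A K ≤ Z A K) :
    expect w t₀ γ Y ≤ expect w t₀ γ Z := by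
  refine Finset.sum_le_sum fun A _ => Finset.sum_le_sum fun K _ =>
    mul_le_mul_of_nonneg_left (h A K) (mul_nonneg ?_ ?_)
  · refine Finset.prod_nonneg fun i _ => Finset.prod_nonneg fun ℓ _ => berProb_nonneg ?_ ?_ _
    · exact (actWeight_pos (hw i).1 _ _).le
    · linarith [actWeight_le (v := w i) (A i) ℓ, (hw i).2]
  · exact Finset.prod_nonneg fun i _ => Finset.prod_nonneg fun ℓ _ =>
      berProb_nonneg (keepProb_pos hγ _).le (keepProb_le_one _) _

theorem expect_abs_le (hw : ∀ i, 0 < w i ∧ w i ≤ 1 / 2) (hγ : 1 ≤ γ)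
    (Y : (Fin n → Fin T → Bool) → (Fin n → Fin T → Bool) → ℝ) :
    expect w t₀ γ (fun A K => |Y A K|) ≤ Real.sqrt (expect w t₀ γ (fun A K => Y A K ^ 2)) := by
  set m := expect w t₀ γ (fun A K => |Y A K|) with hm
  -- Cauchy–Schwarz from the nonnegativity of the mean of `(|Y| - m)²`.
  have h : expect w t₀ γ (fun (_ _ : Fin n → Fin T → Bool) => (0 : ℝ)) ≤
      expect w t₀ γ (fun A K => Y A K ^ 2 + ((-2 * m) * |Y A K| + m ^ 2)) := by
    refine expect_mono hw hγ fun A K => ?_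
    have := sq_nonneg (|Y A K| - m)
    rw [sub_sq, sq_abs] at this
    linarith
  rw [expect_const, expect_add, expect_add, expect_const_mul, expect_const, ← hm] at h
  exact Real.le_sqrt_of_sq_le (by linarith)

/-- The indicator of the event that the history `a` contains no activation. -/
noncomputable def inactive (a : Fin T → Bool) : ℝ := if ∀ s, a s = false then 1 else 0

theorem inactive_nonneg (a : Fin T → Bool) : 0 ≤ inactive a := by
  unfold inactive
  split_ifs <;> norm_num

theorem inactive_le_one (a : Fin T → Bool) : inactive a ≤ 1 := by
  unfold inactive
  split_ifs <;> norm_num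

theorem inactive_extend (A : Fin n → Fin T → Bool) (α : Fin n → Bool) (i : Fin n) :
    inactive (extend A α i) = inactive (A i) * if α i = true then 0 else 1 := by
  unfold inactive
  simp only [Fin.forall_fin_succ', extend_castSucc, extend_last]
  cases α i <;> simp

theorem expect_inactive_le (hw : ∀ i, 0 < w i ∧ w i ≤ 1 / 2) (hγ : 1 ≤ γ) (i : Fin n) :
    T * expect w t₀ γ (fun (A _ : Fin n → Fin T → Bool) => inactive (A i)) ≤ (w i)⁻¹ := by
  have hi := (hw i).1
  induction T with
  | zero => simpa using hi.le
  | succ T ih =>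
    have hle1 : expect w t₀ γ (fun (A _ : Fin n → Fin T → Bool) => inactive (A i)) ≤ 1 :=
      (expect_mono hw hγ fun A _ => inactive_le_one (A i)).trans_eq (expect_const 1)
    have hge0 : 0 ≤ expect w t₀ γ (fun (A _ : Fin n → Fin T → Bool) => inactive (A i)) :=
      (expect_const 0).symm.trans_le (expect_mono hw hγ fun A _ => inactive_nonneg (A i))
    set q := expect w t₀ γ (fun (A _ : Fin n → Fin T → Bool) => inactive (A i))
    have hT : (0 : ℝ) < (T : ℝ) + 1 := by positivity
    have key : expect w t₀ γ (fun (A _ : Fin n → Fin (T + 1) → Bool) => inactive (A i)) =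
        (1 - min (w i) (1 / ((T : ℝ) + 1))) * q := by
      rw [expect_succ, ← expect_const_mul]
      congr 1
      funext A K
      simp only [inactive_extend]
      rw [prodExp_const_mul, prodExp_coord (sum_stepProb A) i (fun c => if c.1 = true then 0 else 1),
        sum_stepProb_mul]
      by_cases h : ∀ s, A i s = false
      · simp [inactive, nextWeight, h]
      · simp [inactive, h]
    rw [key]
    push_cast
    -- If the weight is the minimum, then `T + 1` is already at most its inverse. Otherwise survival
    -- has the factor `T/(T+1)`, which exactly absorbs the growth of the prefactor.
    rcases min_cases (w i) (1 / ((T : ℝ) + 1)) with h | h <;> rw [h.1]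
    · have h2 := h.2
      rw [le_div_iff₀ hT] at h2
      have h3 : (T : ℝ) + 1 ≤ (w i)⁻¹ := by
        rw [← one_div, le_div_iff₀ hi]
        linarith
      refine le_trans ?_ h3
      nlinarith [mul_nonneg hi.le hge0]
    · refine le_trans (le_of_eq ?_) ih
      field_simp
      ring

end Expect

end ParallelGreedy

/-! ### The fractional cut and its martingale. -/

namespace ParallelGreedy

/-- The data of the algorithm: distances, weights and parameters, together with a reference cut
`s`. -/
structure Setup (n : ℕ) where
  d : Fin n → Fin n → ℝ
  w : Fin n → ℝ
  s : Fin n → Fin 2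
  lam : ℝ
  γ : ℝ
  t₀ : ℕ
  d_nonneg : ∀ i j, 0 ≤ d i j
  d_symm : ∀ i j, d i j = d j i
  d_self : ∀ i, d i i = 0
  w_mem : ∀ i, 0 < w i ∧ w i ≤ 1 / 2
  one_le_γ : 1 ≤ γ
  compatible : ∀ i j, d i j / w j ≤ lam * ∑ k, d i k

/-- The row of the side `b`, as a real vector. -/
noncomputable def sideVec (b c : Fin 2) : ℝ := bit (sideRow b c)

theorem sideVec_nonneg (b c : Fin 2) : 0 ≤ sideVec b c := by
  unfold sideVec bit
  split_ifs <;> norm_num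

theorem sideVec_sum (b : Fin 2) : sideVec b 0 + sideVec b 1 = 1 := by
  fin_cases b <;> simp [sideVec, sideRow, bit]

/-- The side that the assignment rule picks for the estimates `C`. -/
noncomputable def greedySide (C : Fin 2 → ℝ) : Fin 2 := if C 0 > C 1 then 1 else 0

/-- A linear functional on the segment of fractional rows is minimised at an endpoint, and the
greedy side is that endpoint. -/
theorem greedySide_le (C z : Fin 2 → ℝ) (h0 : 0 ≤ z 0) (h1 : 0 ≤ z 1) (h : z 0 + z 1 = 1) :
    (sideVec (greedySide C) 0 - z 0) * C 0 + (sideVec (greedySide C) 1 - z 1) * C 1 ≤ 0 := by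
  have hz : z 1 = 1 - z 0 := by linarith
  unfold greedySide
  split_ifs with hC
  · have e0 : sideVec 1 0 = 0 := by simp [sideVec, sideRow, bit]
    have e1 : sideVec 1 1 = 1 := by simp [sideVec, sideRow, bit]
    rw [e0, e1, hz]
    nlinarith [mul_nonneg h0 (sub_nonneg.2 hC.le)]
  · have e0 : sideVec 0 0 = 1 := by simp [sideVec, sideRow, bit]
    have e1 : sideVec 0 1 = 0 := by simp [sideVec, sideRow, bit]
    have := mul_nonneg h1 (sub_nonneg.2 (not_lt.1 hC))
    rw [hz] at this
    rw [e0, e1, hz]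
    linarith

/-- The position at time `t + 1` of a point that stays inactive: `z` is its position at time `t`,
`g` the side it would be assigned to, `p` the probability of its activation. -/
noncomputable def mix (t p z g : ℝ) : ℝ := (t * z + (1 - p * (t + 1)) * g) / ((1 - p) * (t + 1))

/-- Capping the activation probability of inactive points at `1/(t+1)` keeps the coefficient of `g`
nonnegative; `mix` is then a convex combination of `z` and `g`. -/
theorem mix_nonneg {t p z g : ℝ} (ht : 0 ≤ t) (hp : p < 1) (hpt : p * (t + 1) ≤ 1) (hz : 0 ≤ z)
    (hg : 0 ≤ g) : 0 ≤ mix t p z g :=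
  div_nonneg (add_nonneg (mul_nonneg ht hz) (mul_nonneg (by linarith) hg))
    (mul_nonneg (by linarith) (by linarith))

theorem mix_eq {t p z g m : ℝ} (ht : 0 ≤ t) (hp : p < 1) (h : m = mix t p z g) :
    (1 - p) * (t + 1) * m = t * z + (1 - p * (t + 1)) * g := by
  have h1 : 1 - p ≠ 0 := by linarith
  have h2 : t + 1 ≠ 0 := by linarith
  rw [h, mix]
  field_simp

theorem mix_add {t p z g z' g' : ℝ} (ht : 0 ≤ t) (hp : p < 1) (hz : z + z' = 1)
    (hg : g + g' = 1) : mix t p z g + mix t p z' g' = 1 := by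
  have h1 : 1 - p ≠ 0 := by linarith
  have h2 : t + 1 ≠ 0 := by linarith
  obtain rfl : z' = 1 - z := by linarith
  obtain rfl : g' = 1 - g := by linarith
  unfold mix
  field_simp
  ring

theorem mix_self {t p z : ℝ} (ht : 0 ≤ t) (hp : p < 1) : mix t p z z = z := by
  have h1 : 1 - p ≠ 0 := by linarith
  have h2 : t + 1 ≠ 0 := by linarith
  unfold mix
  field_simp
  ring

theorem nextWeight_of_inactive_mul_le {T : ℕ} {v : ℝ} {a : Fin T → Bool} (h : ∀ s, a s = false) :
    nextWeight v a * ((T : ℝ) + 1) ≤ 1 := by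
  have hT : (0 : ℝ) < (T : ℝ) + 1 := by positivity
  rw [← le_div_iff₀ hT, nextWeight, if_pos h]
  exact min_le_right _ _

theorem inv_nextWeight_le {T : ℕ} {v : ℝ} (hv : 0 < v) (a : Fin T → Bool) :
    (nextWeight v a)⁻¹ ≤ v⁻¹ + ((T : ℝ) + 1) * inactive a := by
  have hT : (0 : ℝ) < (T : ℝ) + 1 := by positivity
  have := inv_pos.2 hv
  unfold nextWeight inactive
  split_ifs
  · rcases min_cases v (1 / ((T : ℝ) + 1)) with h | h <;> rw [h.1]
    · linarith
    · rw [one_div, inv_inv]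
      linarith
  · simp

namespace Setup

variable {n T : ℕ} (P : Setup n)

/-- The sum of the distances from the point `i`. -/
noncomputable def D (i : Fin n) : ℝ := ∑ j, P.d i j

theorem D_nonneg (i : Fin n) : 0 ≤ P.D i := Finset.sum_nonneg fun j _ => P.d_nonneg i j

/-- The extension of the sum of internal distances to real matrices. -/
noncomputable def cost (z : Fin n → Fin 2 → ℝ) : ℝ :=
  (1 / 2 : ℝ) * ∑ i, ∑ j, P.d i j * (z i 0 * z j 0 + z i 1 * z j 1)

/-- The total inverse-probability weight of the kept activations of the point `j`. -/
noncomputable def load (A K : Fin n → Fin T → Bool) (j : Fin n) : ℝ :=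
  ∑ ℓ, if A j ℓ = true ∧ K j ℓ = true then
    (actWeight (P.w j) (A j) ℓ * keepProb P.t₀ P.γ (time ℓ))⁻¹ else 0

/-- The side assigned to the point `i` if it is activated at time `T + 1`. -/
noncomputable def choice (T : ℕ) (load : Fin n → ℝ) (z : Fin n → Fin 2 → ℝ) (i : Fin n) : Fin 2 :=
  if T + 1 ≤ P.t₀ then P.s i else greedySide fun b => ∑ j, P.d i j * (load j * z j b)

/-- The fractional cut after a history of length `T`. Activated points sit on their assigned side;
the others move so that their scaled activations form a martingale. -/
noncomputable def frac : (T : ℕ) → (A K : Fin n → Fin T → Bool) → Fin n → Fin 2 → ℝ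
  | 0, _, _ => fun i b => sideVec (P.s i) b
  | T + 1, A, K => fun i b =>
    let A' : Fin n → Fin T → Bool := fun j ℓ => A j ℓ.castSucc
    let K' : Fin n → Fin T → Bool := fun j ℓ => K j ℓ.castSucc
    let z := frac T A' K'
    let g := sideVec (P.choice T (P.load A' K') z i) b
    if ∀ ℓ, A' i ℓ = false then
      if A i (Fin.last T) = true then g else mix T (nextWeight (P.w i) (A' i)) (z i b) g
    else z i b

/-- The row of the side assigned to `i` if it is activated right after the history. -/
noncomputable def target (A K : Fin n → Fin T → Bool) (i : Fin n) (b : Fin 2) : ℝ :=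
  sideVec (P.choice T (P.load A K) (P.frac T A K) i) b

/-- The row of the point `i` in the fractional cut after one further step, which activates the
point if `α = true`. -/
noncomputable def nextFrac (A K : Fin n → Fin T → Bool) (i : Fin n) (b : Fin 2) (α : Bool) : ℝ :=
  if ∀ ℓ, A i ℓ = false then
    if α = true then P.target A K i b
    else mix T (nextWeight (P.w i) (A i)) (P.frac T A K i b) (P.target A K i b)
  else P.frac T A K i b

theorem frac_extend (A K : Fin n → Fin T → Bool) (α κ : Fin n → Bool) (i : Fin n) (b : Fin 2) :
    P.frac (T + 1) (extend A α) (extend K κ) i b = P.nextFrac A K i b (α i) := by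
  simp only [frac, extend_castSucc, extend_last, nextFrac, target]

theorem load_extend (A K : Fin n → Fin T → Bool) (α κ : Fin n → Bool) (j : Fin n) :
    P.load (extend A α) (extend K κ) j = P.load A K j +
      if α j = true ∧ κ j = true then
        (nextWeight (P.w j) (A j) * keepProb P.t₀ P.γ (T + 1))⁻¹ else 0 := by
  simp only [load, Fin.sum_univ_castSucc, extend_castSucc, extend_last, actWeight_extend_castSucc,
    actWeight_extend_last, time, Fin.val_castSucc, Fin.val_last]

theorem load_eq_zero {A : Fin n → Fin T → Bool} (K : Fin n → Fin T → Bool) {j : Fin n}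
    (h : ∀ ℓ, A j ℓ = false) : P.load A K j = 0 := by
  simp [load, h]

theorem nextWeight_lt_one (A : Fin n → Fin T → Bool) (i : Fin n) :
    nextWeight (P.w i) (A i) < 1 := by
  linarith [nextWeight_le (v := P.w i) (A i), (P.w_mem i).2]

theorem frac_mem (A K : Fin n → Fin T → Bool) (i : Fin n) :
    (∀ b, 0 ≤ P.frac T A K i b) ∧ P.frac T A K i 0 + P.frac T A K i 1 = 1 := by
  induction T with
  | zero => exact ⟨fun b => sideVec_nonneg _ _, sideVec_sum _⟩
  | succ T ih =>
    have ih := ih (fun j ℓ => A j ℓ.castSucc) (fun j ℓ => K j ℓ.castSucc)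
    have hw := P.nextWeight_lt_one (fun j (ℓ : Fin T) => A j ℓ.castSucc) i
    simp only [frac]
    split_ifs with h1 h2
    · exact ⟨fun b => sideVec_nonneg _ _, sideVec_sum _⟩
    · exact ⟨fun b => mix_nonneg (Nat.cast_nonneg _) hw (nextWeight_of_inactive_mul_le h1)
        (ih.1 b) (sideVec_nonneg _ _), mix_add (Nat.cast_nonneg _) hw ih.2 (sideVec_sum _)⟩
    · exact ih

theorem frac_nonneg (A K : Fin n → Fin T → Bool) (i : Fin n) (b : Fin 2) :
    0 ≤ P.frac T A K i b := (P.frac_mem A K i).1 b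

theorem frac_le_one (A K : Fin n → Fin T → Bool) (i : Fin n) (b : Fin 2) :
    P.frac T A K i b ≤ 1 := by
  have h := P.frac_mem A K i
  have h0 := h.1 0
  have h1 := h.1 1
  fin_cases b <;> simp <;> linarith [h.2]

theorem target_nonneg (A K : Fin n → Fin T → Bool) (i : Fin n) (b : Fin 2) :
    0 ≤ P.target A K i b := sideVec_nonneg _ _

theorem target_le_one (A K : Fin n → Fin T → Bool) (i : Fin n) (b : Fin 2) :
    P.target A K i b ≤ 1 := by
  unfold target sideVec bit
  split_ifs <;> norm_num

/-- During the seed phase the target is the current row, and mixing a row with itself does not move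
it. -/
theorem frac_eq_of_le (hT : T ≤ P.t₀) (A K : Fin n → Fin T → Bool) (i : Fin n) (b : Fin 2) :
    P.frac T A K i b = sideVec (P.s i) b := by
  induction T with
  | zero => rfl
  | succ T ih =>
    have hw := P.nextWeight_lt_one (fun j (ℓ : Fin T) => A j ℓ.castSucc) i
    simp only [frac, choice, if_pos hT, ih (Nat.le_of_succ_le hT), mix_self (Nat.cast_nonneg T) hw,
      ite_self]

theorem sum_stepProb_nextFrac (A K : Fin n → Fin T → Bool) (i : Fin n) (b : Fin 2) :
    ∑ c, stepProb P.w P.t₀ P.γ A i c * P.nextFrac A K i b c.1 =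
      P.frac T A K i b + 1 / ((T : ℝ) + 1) *
        (inactive (A i) * (P.target A K i b - P.frac T A K i b)) := by
  rw [sum_stepProb_mul]
  unfold nextFrac inactive
  simp only [if_true, Bool.false_eq_true, if_false]
  split_ifs with h
  · have hT : (T : ℝ) + 1 ≠ 0 := by positivity
    have hw := P.nextWeight_lt_one A i
    generalize hm : mix _ _ _ _ = m
    have := mix_eq (Nat.cast_nonneg T) hw hm.symm
    field_simp
    linear_combination this
  · ring

/-- The deviation of the scaled activations of the point `j` on the side `b` from their mean. -/
noncomputable def dev (A K : Fin n → Fin T → Bool) (j : Fin n) (b : Fin 2) : ℝ :=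
  (P.load A K j - T) * P.frac T A K j b

/-- The deviation after one further step with the entries `c` for the point `j`. -/
noncomputable def nextDev (A K : Fin n → Fin T → Bool) (j : Fin n) (b : Fin 2)
    (c : Bool × Bool) : ℝ :=
  (P.load A K j + (if c.1 = true ∧ c.2 = true then
    (nextWeight (P.w j) (A j) * keepProb P.t₀ P.γ (T + 1))⁻¹ else 0) - ((T : ℝ) + 1)) *
    P.nextFrac A K j b c.1

theorem dev_extend (A K : Fin n → Fin T → Bool) (c : Fin n → Bool × Bool) (j : Fin n)
    (b : Fin 2) :
    P.dev (extend A fun i => (c i).1) (extend K fun i => (c i).2) j b =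
      P.nextDev A K j b (c j) := by
  simp only [dev, frac_extend, load_extend, nextDev, Nat.cast_add, Nat.cast_one]

/-- For an active point the inverse-probability increment has mean one and the row is frozen. For an
inactive one the identity reads `g - p(T+1)g - (1-p)(T+1)m = -Tz`, the equation that defines `mix`.
-/
theorem sum_stepProb_nextDev (A K : Fin n → Fin T → Bool) (j : Fin n) (b : Fin 2) :
    ∑ c, stepProb P.w P.t₀ P.γ A j c * P.nextDev A K j b c = P.dev A K j b := by
  have hp := (nextWeight_pos (P.w_mem j).1 (A j)).ne'
  have hq := (keepProb_pos (t₀ := P.t₀) P.one_le_γ T).ne'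
  have hw := P.nextWeight_lt_one A j
  rw [sum_stepProb_mul]
  unfold nextDev nextFrac dev
  simp only [and_self, if_true, Bool.false_eq_true, if_false, and_false, false_and]
  split_ifs with h
  · rw [P.load_eq_zero K h]
    generalize hm : mix _ _ _ _ = m
    have := mix_eq (Nat.cast_nonneg T) hw hm.symm
    field_simp
    linear_combination (-1 : ℝ) * this
  · field_simp
    ring

theorem sum_stepProb_nextDev_sq_le (A K : Fin n → Fin T → Bool) (j : Fin n) (b : Fin 2) :
    ∑ c, stepProb P.w P.t₀ P.γ A j c * (P.nextDev A K j b c - P.dev A K j b) ^ 2 ≤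
      5 * (nextWeight (P.w j) (A j))⁻¹ * (keepProb P.t₀ P.γ (T + 1))⁻¹ := by
  have hp := nextWeight_pos (P.w_mem j).1 (A j)
  have hq := keepProb_pos (t₀ := P.t₀) P.one_le_γ T
  have hq1 := keepProb_le_one (t₀ := P.t₀) (γ := P.γ) (T + 1)
  have hw := P.nextWeight_lt_one A j
  have hz0 := P.frac_nonneg A K j b
  have hz1 := P.frac_le_one A K j b
  have hg0 := P.target_nonneg A K j b
  have hg1 := P.target_le_one A K j b
  have hT0 : (0 : ℝ) ≤ T := Nat.cast_nonneg T
  rw [sum_stepProb_mul]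
  unfold nextDev nextFrac dev
  simp only [and_self, if_true, Bool.false_eq_true, if_false, and_false, false_and]
  have hpt (h : ∀ ℓ, A j ℓ = false) := nextWeight_of_inactive_mul_le (v := P.w j) h
  generalize nextWeight (P.w j) (A j) = p at *
  generalize keepProb P.t₀ P.γ (T + 1) = q at *
  generalize P.frac T A K j b = z at *
  generalize P.target A K j b = g at *
  have hpq : 0 < p * q := mul_pos hp hq
  have hr : 1 ≤ p⁻¹ * q⁻¹ := by
    rw [← mul_inv]
    exact (one_le_inv₀ hpq).2 (by nlinarith)
  split_ifs with h
  · rw [P.load_eq_zero K h]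
    have hpt := hpt h
    generalize hm : mix _ _ _ _ = m
    have hmix := mix_eq hT0 hw hm.symm
    generalize (T : ℝ) = t at *
    have hpi : t + 1 ≤ p⁻¹ := by
      rw [← one_div, le_div_iff₀ hp]
      linarith
    have hqi : 1 ≤ q⁻¹ := (one_le_inv₀ hq).2 hq1
    have hpi0 := inv_pos.2 hp
    -- an activation
    set y := t * z - (t + 1) * g with hy
    have hy2 : y ^ 2 ≤ (t + 1) ^ 2 := by
      refine sq_le_sq' ?_ ?_ <;> nlinarith
    have e11 : ((0 + (p * q)⁻¹ - (t + 1)) * g - (0 - t) * z) ^ 2 ≤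
        2 * (p⁻¹ * q⁻¹) ^ 2 + 2 * (t + 1) ^ 2 := by
      have e : (0 + (p * q)⁻¹ - (t + 1)) * g - (0 - t) * z = (p⁻¹ * q⁻¹) * g + y := by
        rw [mul_inv]
        ring
      have hg2 : ((p⁻¹ * q⁻¹) * g) ^ 2 ≤ (p⁻¹ * q⁻¹) ^ 2 := by
        rw [mul_pow]
        exact mul_le_of_le_one_right (sq_nonneg _) (pow_le_one₀ hg0 hg1)
      rw [e]
      nlinarith [sq_nonneg ((p⁻¹ * q⁻¹) * g - y)]
    have e10 : ((0 + 0 - (t + 1)) * g - (0 - t) * z) ^ 2 ≤ 2 * (t + 1) ^ 2 := by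
      have e : (0 + 0 - (t + 1)) * g - (0 - t) * z = y := by
        rw [hy]
        ring
      rw [e]
      nlinarith [sq_nonneg (t + 1)]
    -- no activation
    have e0 : ((0 + 0 - (t + 1)) * m - (0 - t) * z) ^ 2 ≤ 1 := by
      have e : (1 - p) * ((0 + 0 - (t + 1)) * m - (0 - t) * z) =
          -(p * t * z + (1 - p * (t + 1)) * g) := by
        linear_combination (-1 : ℝ) * hmix
      have h1 : 0 ≤ p * t * z + (1 - p * (t + 1)) * g :=
        add_nonneg (by positivity) (mul_nonneg (by linarith) hg0)
      have h2 : p * t * z + (1 - p * (t + 1)) * g ≤ 1 - p := by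
        have : p * t * z ≤ p * t := mul_le_of_le_one_right (by positivity) hz1
        have : (1 - p * (t + 1)) * g ≤ 1 - p * (t + 1) :=
          mul_le_of_le_one_right (by linarith) hg1
        linarith
      have hp1 : 0 < 1 - p := by linarith
      rw [sq_le_one_iff_abs_le_one, abs_le]
      constructor <;> nlinarith
    -- The constant 5 is 2 + 2 + 1: a kept activation, the drift upon activation (using `p * (t + 1)
    -- ≤ 1` and `t + 1 ≤ p⁻¹`), and the step without activation.
    calc _ ≤ p * (q * (2 * (p⁻¹ * q⁻¹) ^ 2 + 2 * (t + 1) ^ 2) +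
          (1 - q) * (2 * (t + 1) ^ 2)) + (1 - p) * (q * 1 + (1 - q) * 1) := by
            have h1q : 0 ≤ 1 - q := by linarith
            have h1p : 0 ≤ 1 - p := by linarith
            gcongr
      _ = 2 * (p⁻¹ * q⁻¹) + 2 * (p * (t + 1)) * (t + 1) + (1 - p) := by
            field_simp
            ring
      _ ≤ 2 * (p⁻¹ * q⁻¹) + 2 * (p⁻¹ * q⁻¹) + p⁻¹ * q⁻¹ := by
            have h1 : p * (t + 1) * (t + 1) ≤ 1 * (t + 1) :=
              mul_le_mul_of_nonneg_right hpt (by linarith)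
            have h2 : p⁻¹ * 1 ≤ p⁻¹ * q⁻¹ := mul_le_mul_of_nonneg_left hqi hpi0.le
            linarith
      _ = 5 * p⁻¹ * q⁻¹ := by ring
  -- The row of an active point is frozen, so this is the variance of a Bernoulli variable of
  -- parameter `p * q` scaled by its inverse.
  · calc _ = (p⁻¹ * q⁻¹ - 1) * z ^ 2 := by
            field_simp
            ring
      _ ≤ (p⁻¹ * q⁻¹ - 1) * 1 :=
            mul_le_mul_of_nonneg_left (pow_le_one₀ hz0 hz1) (by linarith)
      _ ≤ 5 * p⁻¹ * q⁻¹ := by linarith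

end Setup

end ParallelGreedy

/-! ### Second moment of the estimation error. -/

namespace ParallelGreedy

namespace Setup

variable {n T : ℕ} (P : Setup n)

/-- The error of the estimate of the total distance from the point `i` to the side `b`. -/
noncomputable def noise (A K : Fin n → Fin T → Bool) (i : Fin n) (b : Fin 2) : ℝ :=
  ∑ j, P.d i j * P.dev A K j b

/-- Compatibility enters the variance here: one factor of each squared distance absorbs the inverse
weight. -/
theorem sum_sq_div_le (i : Fin n) : ∑ j, P.d i j ^ 2 * (P.w j)⁻¹ ≤ P.lam * P.D i ^ 2 := by
  calc ∑ j, P.d i j ^ 2 * (P.w j)⁻¹ ≤ ∑ j, P.d i j * (P.lam * P.D i) := by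
        refine Finset.sum_le_sum fun j _ => ?_
        have := mul_le_mul_of_nonneg_left (P.compatible i j) (P.d_nonneg i j)
        rw [div_eq_mul_inv] at this
        exact le_trans (le_of_eq (by ring)) this
    _ = P.lam * P.D i ^ 2 := by
        rw [← Finset.sum_mul]
        change P.D i * _ = _
        ring

theorem prodExp_noise_sq_le (A K : Fin n → Fin T → Bool) (i : Fin n) (b : Fin 2) :
    prodExp (stepProb P.w P.t₀ P.γ A) (fun c =>
      P.noise (extend A fun j => (c j).1) (extend K fun j => (c j).2) i b ^ 2) ≤
    P.noise A K i b ^ 2 + ∑ j, P.d i j ^ 2 * (5 * (keepProb P.t₀ P.γ (T + 1))⁻¹) *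
      ((P.w j)⁻¹ + ((T : ℝ) + 1) * inactive (A j)) := by
  simp only [noise, dev_extend]
  rw [prodExp_sq_sum (sum_stepProb A) (fun j c => P.d i j * P.nextDev A K j b c)
    (fun j => P.d i j * P.dev A K j b)]
  · gcongr with j
    have h1 := P.sum_stepProb_nextDev_sq_le A K j b
    have h2 := inv_nextWeight_le (P.w_mem j).1 (A j)
    have hq := inv_pos.2 (keepProb_pos (t₀ := P.t₀) P.one_le_γ T)
    calc _ = P.d i j ^ 2 * ∑ c, stepProb P.w P.t₀ P.γ A j c *
            (P.nextDev A K j b c - P.dev A K j b) ^ 2 := by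
          rw [Finset.mul_sum]
          exact Finset.sum_congr rfl fun c _ => by ring
      _ ≤ P.d i j ^ 2 *
            (5 * (nextWeight (P.w j) (A j))⁻¹ * (keepProb P.t₀ P.γ (T + 1))⁻¹) := by gcongr
      _ = P.d i j ^ 2 * (5 * (keepProb P.t₀ P.γ (T + 1))⁻¹) *
            (nextWeight (P.w j) (A j))⁻¹ := by ring
      _ ≤ _ := by gcongr
  · intro j
    rw [← sum_stepProb_nextDev, Finset.mul_sum]
    exact Finset.sum_congr rfl fun c _ => by ring

theorem add_one_mul_expect_inactive_le (i : Fin n) :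
    ((T : ℝ) + 1) * expect P.w P.t₀ P.γ (fun (A _ : Fin n → Fin T → Bool) => inactive (A i)) ≤
      2 * (P.w i)⁻¹ := by
  have h1 := expect_inactive_le (T := T) (t₀ := P.t₀) P.w_mem P.one_le_γ i
  have h2 : expect P.w P.t₀ P.γ (fun (A _ : Fin n → Fin T → Bool) => inactive (A i)) ≤ 1 :=
    (expect_mono P.w_mem P.one_le_γ fun A _ => inactive_le_one (A i)).trans_eq (expect_const 1)
  have h3 : 1 ≤ (P.w i)⁻¹ :=
    (one_le_inv₀ (P.w_mem i).1).2 (by linarith [(P.w_mem i).2])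
  linarith

/-- Martingale increments add in variance. The constant is 5 from the single-step bound times 3: the
mean inverse activation probability is at most `3 / w j`, one part from the weight and two from the
cap on inactive points. -/
theorem expect_noise_sq_le (i : Fin n) (b : Fin 2) :
    expect P.w P.t₀ P.γ (fun (A K : Fin n → Fin T → Bool) => P.noise A K i b ^ 2) ≤
      15 * (P.lam * P.D i ^ 2) * (T + (T : ℝ) ^ 2 / P.γ) := by
  have hγ : 0 < P.γ := lt_of_lt_of_le one_pos P.one_le_γ
  induction T with
  | zero =>
    have : ∀ A K : Fin n → Fin 0 → Bool, P.noise A K i b ^ 2 = 0 := fun A K => by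
      simp [noise, dev, load]
    simp only [this, expect_const]
    simp
  | succ T ih =>
    have hS : 0 ≤ ∑ j, P.d i j ^ 2 * (P.w j)⁻¹ :=
      Finset.sum_nonneg fun j _ => mul_nonneg (sq_nonneg _) (inv_pos.2 (P.w_mem j).1).le
    have hle := P.sum_sq_div_le i
    have hq := inv_pos.2 (keepProb_pos (t₀ := P.t₀) P.one_le_γ T)
    have hq' := inv_keepProb_le (t₀ := P.t₀) P.one_le_γ T
    have h0 : 0 ≤ 15 * (P.lam * P.D i ^ 2) := by linarith
    rw [expect_succ]
    refine (expect_mono P.w_mem P.one_le_γ fun A K => P.prodExp_noise_sq_le A K i b).trans ?_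
    rw [expect_add, expect_sum]
    have hinc : ∑ j, expect P.w P.t₀ P.γ (fun (A _ : Fin n → Fin T → Bool) =>
        P.d i j ^ 2 * (5 * (keepProb P.t₀ P.γ (T + 1))⁻¹) *
          ((P.w j)⁻¹ + ((T : ℝ) + 1) * inactive (A j))) ≤
        15 * (P.lam * P.D i ^ 2) * (1 + ((T : ℝ) + 1) / P.γ) := by
      calc _ ≤ ∑ j, P.d i j ^ 2 * (5 * (keepProb P.t₀ P.γ (T + 1))⁻¹) * (3 * (P.w j)⁻¹) := by
            refine Finset.sum_le_sum fun j _ => ?_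
            rw [expect_const_mul, expect_add, expect_const, expect_const_mul]
            have := P.add_one_mul_expect_inactive_le (T := T) j
            refine mul_le_mul_of_nonneg_left (by linarith) (by positivity)
        _ = 15 * (∑ j, P.d i j ^ 2 * (P.w j)⁻¹) * (keepProb P.t₀ P.γ (T + 1))⁻¹ := by
            rw [Finset.mul_sum, Finset.sum_mul]
            exact Finset.sum_congr rfl fun j _ => by ring
        _ ≤ 15 * (P.lam * P.D i ^ 2) * (1 + ((T : ℝ) + 1) / P.γ) :=
            mul_le_mul (by linarith) hq' hq.le h0
    have hfin : (T + (T : ℝ) ^ 2 / P.γ) + (1 + ((T : ℝ) + 1) / P.γ) ≤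
        ((T + 1 : ℕ) : ℝ) + ((T + 1 : ℕ) : ℝ) ^ 2 / P.γ := by
      push_cast
      have : ((T : ℝ) ^ 2 + (T + 1)) / P.γ ≤ ((T : ℝ) + 1) ^ 2 / P.γ := by
        gcongr
        nlinarith [(Nat.cast_nonneg T : (0 : ℝ) ≤ T)]
      rw [add_div] at this
      linarith
    refine (add_le_add ih hinc).trans ?_
    rw [← mul_add]
    exact mul_le_mul_of_nonneg_left hfin h0

theorem expect_abs_noise_le (hlam : 0 ≤ P.lam) (i : Fin n) (b : Fin 2) :
    expect P.w P.t₀ P.γ (fun (A K : Fin n → Fin T → Bool) => |P.noise A K i b|) ≤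
      4 * P.D i * (√P.lam * √T + T * √(P.lam / P.γ)) := by
  have hγ : 0 < P.γ := lt_of_lt_of_le one_pos P.one_le_γ
  have hD := P.D_nonneg i
  have hb : 0 ≤ √P.lam * √T + T * √(P.lam / P.γ) := by positivity
  refine (expect_abs_le P.w_mem P.one_le_γ _).trans ?_
  refine Real.sqrt_le_iff.2 ⟨by positivity, (P.expect_noise_sq_le i b).trans ?_⟩
  have h1 : (√P.lam * √T) ^ 2 = P.lam * T := by
    rw [mul_pow, Real.sq_sqrt hlam, Real.sq_sqrt (Nat.cast_nonneg T)]
  have h2 : (T * √(P.lam / P.γ)) ^ 2 = P.lam * ((T : ℝ) ^ 2 / P.γ) := by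
    rw [mul_pow, Real.sq_sqrt (by positivity)]
    ring
  -- The cross term of the square is dropped; the factor 4 comes from `15 ≤ 4²`.
  have h3 : P.lam * (T + (T : ℝ) ^ 2 / P.γ) ≤ (√P.lam * √T + T * √(P.lam / P.γ)) ^ 2 := by
    rw [add_sq, h1, h2]
    have : 0 ≤ 2 * (√P.lam * √T) * (T * √(P.lam / P.γ)) := by positivity
    linarith
  have h4 : 0 ≤ P.lam * (T + (T : ℝ) ^ 2 / P.γ) := by positivity
  rw [mul_pow]
  calc _ = 15 * P.D i ^ 2 * (P.lam * (T + (T : ℝ) ^ 2 / P.γ)) := by ring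
    _ ≤ (4 * P.D i) ^ 2 * (P.lam * (T + (T : ℝ) ^ 2 / P.γ)) := by
        gcongr
        nlinarith [sq_nonneg (P.D i)]
    _ ≤ _ := by gcongr

/-! ### The evolution of the cost -/

theorem cost_add_mul (z u : Fin n → Fin 2 → ℝ) (a : ℝ) :
    P.cost (fun i b => z i b + a * u i b) = P.cost z +
      a * (∑ i, (u i 0 * ∑ j, P.d i j * z j 0 + u i 1 * ∑ j, P.d i j * z j 1)) +
      a ^ 2 * P.cost u := by
  have hsymm : ∑ i, ∑ j, P.d i j * (z i 0 * u j 0 + z i 1 * u j 1) =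
      ∑ i, ∑ j, P.d i j * (u i 0 * z j 0 + u i 1 * z j 1) := by
    rw [Finset.sum_comm]
    refine Finset.sum_congr rfl fun i _ => Finset.sum_congr rfl fun j _ => ?_
    rw [P.d_symm j i]
    ring
  have hlin : ∑ i, (u i 0 * ∑ j, P.d i j * z j 0 + u i 1 * ∑ j, P.d i j * z j 1) =
      ∑ i, ∑ j, P.d i j * (u i 0 * z j 0 + u i 1 * z j 1) := by
    refine Finset.sum_congr rfl fun i _ => ?_
    rw [Finset.mul_sum, Finset.mul_sum, ← Finset.sum_add_distrib]
    exact Finset.sum_congr rfl fun j _ => by ring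
  rw [hlin]
  unfold cost
  have hexp : ∑ i, ∑ j, P.d i j * ((z i 0 + a * u i 0) * (z j 0 + a * u j 0) +
      (z i 1 + a * u i 1) * (z j 1 + a * u j 1)) =
      ∑ i, ∑ j, P.d i j * (z i 0 * z j 0 + z i 1 * z j 1) +
      a * ∑ i, ∑ j, P.d i j * (z i 0 * u j 0 + z i 1 * u j 1) +
      a * ∑ i, ∑ j, P.d i j * (u i 0 * z j 0 + u i 1 * z j 1) +
      a ^ 2 * ∑ i, ∑ j, P.d i j * (u i 0 * u j 0 + u i 1 * u j 1) := by
    simp only [Finset.mul_sum, ← Finset.sum_add_distrib]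
    exact Finset.sum_congr rfl fun i _ => Finset.sum_congr rfl fun j _ => by ring
  rw [hexp, hsymm]
  ring

theorem cost_le_of_abs_le_one {u : Fin n → Fin 2 → ℝ} (hu : ∀ i b, |u i b| ≤ 1) :
    P.cost u ≤ ∑ i, P.D i := by
  have h : ∀ i j b, u i b * u j b ≤ 1 := fun i j b => by
    refine (le_abs_self _).trans ?_
    rw [abs_mul]
    exact mul_le_one₀ (hu i b) (abs_nonneg _) (hu j b)
  unfold cost D
  rw [Finset.mul_sum]
  refine Finset.sum_le_sum fun i _ => ?_
  rw [Finset.mul_sum]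
  refine Finset.sum_le_sum fun j _ => ?_
  have := mul_le_mul_of_nonneg_left (add_le_add (h i j 0) (h i j 1)) (P.d_nonneg i j)
  linarith

/-- The direction in which the fractional cut moves in expectation. -/
noncomputable def shift (A K : Fin n → Fin T → Bool) (i : Fin n) (b : Fin 2) : ℝ :=
  inactive (A i) * (P.target A K i b - P.frac T A K i b)

theorem abs_shift_le_one (A K : Fin n → Fin T → Bool) (i : Fin n) (b : Fin 2) :
    |P.shift A K i b| ≤ 1 := by
  unfold shift
  rw [abs_mul, abs_of_nonneg (inactive_nonneg _)]
  refine mul_le_one₀ (inactive_le_one _) (abs_nonneg _) (abs_le.2 ⟨?_, ?_⟩)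
  · linarith [P.target_nonneg A K i b, P.frac_le_one A K i b]
  · linarith [P.target_le_one A K i b, P.frac_nonneg A K i b]

/-- The cost is bilinear in distinct, conditionally independent rows, and the diagonal vanishes;
averaging therefore passes inside. -/
theorem prodExp_cost_extend (A K : Fin n → Fin T → Bool) :
    prodExp (stepProb P.w P.t₀ P.γ A) (fun c =>
      P.cost (P.frac (T + 1) (extend A fun j => (c j).1) (extend K fun j => (c j).2))) =
    P.cost (fun i b => P.frac T A K i b + 1 / ((T : ℝ) + 1) * P.shift A K i b) := by
  unfold cost shift
  simp only [frac_extend, ← sum_stepProb_nextFrac]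
  rw [prodExp_const_mul, prodExp_sum]
  congr 1
  refine Finset.sum_congr rfl fun i _ => ?_
  rw [prodExp_sum]
  refine Finset.sum_congr rfl fun j _ => ?_
  rw [prodExp_const_mul]
  by_cases hij : i = j
  · subst hij
    simp [P.d_self]
  · congr 1
    have h (b : Fin 2) := prodExp_coord_mul (sum_stepProb (w := P.w) (t₀ := P.t₀) (γ := P.γ) A) hij
      (fun c => P.nextFrac A K i b c.1) (fun c => P.nextFrac A K j b c.1)
    rw [← h 0, ← h 1]
    simp only [prodExp, mul_add, Finset.sum_add_distrib]

/-- The greedy step descends for the estimates `C`, which are `T` times the true sums plus noise;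
only the noise can make the true first-order change positive. -/
theorem shift_mul_le (hT : P.t₀ ≤ T) (hT0 : 0 < T) (A K : Fin n → Fin T → Bool) (i : Fin n) :
    P.shift A K i 0 * (∑ j, P.d i j * P.frac T A K j 0) +
      P.shift A K i 1 * (∑ j, P.d i j * P.frac T A K j 1) ≤
    1 / (T : ℝ) * (|P.noise A K i 0| + |P.noise A K i 1|) := by
  have hT0' : (0 : ℝ) < T := by exact_mod_cast hT0
  set C : Fin 2 → ℝ := fun b => ∑ j, P.d i j * (P.load A K j * P.frac T A K j b) with hC
  have hnoise : ∀ b, T * (∑ j, P.d i j * P.frac T A K j b) = C b - P.noise A K i b := fun b => by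
    simp only [hC, noise, dev, Finset.mul_sum, ← Finset.sum_sub_distrib]
    exact Finset.sum_congr rfl fun j _ => by ring
  have hgreedy : P.shift A K i 0 * C 0 + P.shift A K i 1 * C 1 ≤ 0 := by
    have hf := P.frac_mem A K i
    have := greedySide_le C (P.frac T A K i) (hf.1 0) (hf.1 1) hf.2
    have ht : ∀ b, P.target A K i b = sideVec (greedySide C) b := fun b => by
      unfold target choice
      rw [if_neg (by omega)]
    unfold shift
    rw [ht, ht]
    have := mul_nonpos_of_nonneg_of_nonpos (inactive_nonneg (A i)) this
    linarith
  have habs : ∀ b, -(P.shift A K i b * P.noise A K i b) ≤ |P.noise A K i b| := fun b => by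
    refine (neg_le_abs _).trans ?_
    rw [abs_mul]
    exact mul_le_of_le_one_left (abs_nonneg _) (P.abs_shift_le_one A K i b)
  have h0 := hnoise 0
  have h1 := hnoise 1
  rw [one_div, ← div_eq_inv_mul, le_div_iff₀ hT0']
  have e : (P.shift A K i 0 * (∑ j, P.d i j * P.frac T A K j 0) +
      P.shift A K i 1 * (∑ j, P.d i j * P.frac T A K j 1)) * T =
      P.shift A K i 0 * (C 0 - P.noise A K i 0) + P.shift A K i 1 * (C 1 - P.noise A K i 1) := by
    rw [← h0, ← h1]
    ring
  rw [e]
  linarith [habs 0, habs 1]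

theorem expect_cost_succ_le (hlam : 0 ≤ P.lam) (hT : P.t₀ ≤ T) (hT0 : 0 < T) :
    expect P.w P.t₀ P.γ (fun A K => P.cost (P.frac (T + 1) A K)) ≤
      expect P.w P.t₀ P.γ (fun A K => P.cost (P.frac T A K)) +
      (8 * (√P.lam * (1 / (√T * ((T : ℝ) + 1))) + √(P.lam / P.γ) * (1 / ((T : ℝ) + 1))) +
        1 / ((T : ℝ) + 1) ^ 2) * ∑ i, P.D i := by
  have hT0' : (0 : ℝ) < T := by exact_mod_cast hT0
  have hT1 : (0 : ℝ) < (T : ℝ) + 1 := by positivity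
  rw [expect_succ]
  have hstep : ∀ A K : Fin n → Fin T → Bool, prodExp (stepProb P.w P.t₀ P.γ A) (fun c =>
      P.cost (P.frac (T + 1) (extend A fun j => (c j).1) (extend K fun j => (c j).2))) ≤
      P.cost (P.frac T A K) + (1 / ((T : ℝ) + 1) * (1 / (T : ℝ)) *
        (∑ i, (|P.noise A K i 0| + |P.noise A K i 1|)) +
        (1 / ((T : ℝ) + 1)) ^ 2 * ∑ i, P.D i) := fun A K => by
    rw [prodExp_cost_extend, cost_add_mul, mul_assoc, Finset.mul_sum (a := 1 / (T : ℝ)), ← add_assoc]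
    have h1 := P.cost_le_of_abs_le_one (P.abs_shift_le_one A K)
    gcongr with i
    exact P.shift_mul_le hT hT0 A K i
  refine (expect_mono P.w_mem P.one_le_γ hstep).trans ?_
  rw [expect_add, expect_add, expect_const_mul, expect_const, expect_sum]
  refine add_le_add le_rfl ?_
  have hsum : ∑ i, expect P.w P.t₀ P.γ (fun (A K : Fin n → Fin T → Bool) =>
      |P.noise A K i 0| + |P.noise A K i 1|) ≤
      ∑ i, 8 * P.D i * (√P.lam * √T + T * √(P.lam / P.γ)) := by
    refine Finset.sum_le_sum fun i _ => ?_
    rw [expect_add]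
    have h0 := P.expect_abs_noise_le (T := T) hlam i 0
    have h1 := P.expect_abs_noise_le (T := T) hlam i 1
    linarith
  calc _ ≤ 1 / ((T : ℝ) + 1) * (1 / (T : ℝ)) *
          (∑ i, 8 * P.D i * (√P.lam * √T + T * √(P.lam / P.γ))) +
          (1 / ((T : ℝ) + 1)) ^ 2 * ∑ i, P.D i := by gcongr
    _ = _ := by
      rw [← Finset.sum_mul, ← Finset.mul_sum]
      have hs : √(T : ℝ) ≠ 0 := (Real.sqrt_pos.2 hT0').ne'
      have hs2 : (T : ℝ) = √(T : ℝ) * √(T : ℝ) := (Real.mul_self_sqrt hT0'.le).symm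
      have e : 1 / (T : ℝ) * (√P.lam * √T + T * √(P.lam / P.γ)) =
          √P.lam * (1 / √T) + √(P.lam / P.γ) := by
        field_simp
        linear_combination (-√P.lam) * hs2
      have e2 : √P.lam * (1 / (√T * ((T : ℝ) + 1))) = √P.lam * (1 / √T) * (1 / ((T : ℝ) + 1)) := by
        rw [mul_assoc, one_div_mul_one_div]
      rw [e2, ← one_div_pow]
      linear_combination (1 / ((T : ℝ) + 1) * (8 * ∑ i, P.D i)) * e

theorem expect_cost_eq_of_le (hT : T ≤ P.t₀) :
    expect P.w P.t₀ P.γ (fun (A K : Fin n → Fin T → Bool) => P.cost (P.frac T A K)) =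
      P.cost (fun i b => sideVec (P.s i) b) := by
  have : ∀ A K : Fin n → Fin T → Bool, P.frac T A K = fun i b => sideVec (P.s i) b :=
    fun A K => by
      funext i b
      exact P.frac_eq_of_le hT A K i b
  simp only [this, expect_const]

/-- Makes the `√lam` terms telescope; with `a = √t` and `b = √(t+1)` it rests on `2(b-a)b ≥ b² - a²
= 1`. -/
theorem one_div_sqrt_mul_le {t : ℝ} (ht : 0 < t) :
    1 / (√t * (t + 1)) ≤ 2 * (1 / √t - 1 / √(t + 1)) := by
  have h1 : 0 < √t := Real.sqrt_pos.2 ht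
  have h2 : 0 < √(t + 1) := Real.sqrt_pos.2 (by linarith)
  have h3 : √t ≤ √(t + 1) := Real.sqrt_le_sqrt (by linarith)
  have e1 : √t ^ 2 = t := Real.sq_sqrt ht.le
  have e2 : √(t + 1) ^ 2 = t + 1 := Real.sq_sqrt (by linarith)
  generalize √t = a at *
  generalize √(t + 1) = b at *
  rw [← e2, div_sub_div _ _ h1.ne' h2.ne', ← mul_div_assoc, div_le_div_iff₀ (by positivity)
    (by positivity)]
  have : 1 ≤ 2 * (b - a) * b := by nlinarith
  nlinarith [mul_pos h1 h2]

theorem expect_cost_le (hlam : 0 ≤ P.lam) (ht₀ : 0 < P.t₀) (hT : P.t₀ ≤ T) :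
    expect P.w P.t₀ P.γ (fun (A K : Fin n → Fin T → Bool) => P.cost (P.frac T A K)) ≤
      P.cost (fun i b => sideVec (P.s i) b) +
      (16 * √P.lam * (1 / √P.t₀ - 1 / √T) + 8 * √(P.lam / P.γ) * (harmonic T : ℝ) +
        (1 / (P.t₀ : ℝ) - 1 / (T : ℝ))) * ∑ i, P.D i := by
  have hD : 0 ≤ ∑ i, P.D i := Finset.sum_nonneg fun i _ => P.D_nonneg i
  induction T, hT using Nat.le_induction with
  | base =>
    rw [P.expect_cost_eq_of_le le_rfl]
    -- The bound uses the full harmonic number rather than its part after `t₀`, so at the start a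
    -- nonnegative surplus remains.
    have : (0 : ℝ) ≤ (harmonic P.t₀ : ℝ) := by
      unfold harmonic
      push_cast
      positivity
    simp only [sub_self, mul_zero, zero_add, add_zero, le_add_iff_nonneg_right]
    positivity
  | succ T hT ih =>
    have hT0 : 0 < T := lt_of_lt_of_le ht₀ hT
    have hT0' : (0 : ℝ) < T := by exact_mod_cast hT0
    refine (P.expect_cost_succ_le hlam hT hT0).trans ?_
    refine (add_le_add_left ih _).trans ?_
    rw [add_assoc, ← add_mul]
    refine add_le_add le_rfl (mul_le_mul_of_nonneg_right ?_ hD)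
    rw [harmonic_succ]
    push_cast
    have h1 := mul_le_mul_of_nonneg_left (one_div_sqrt_mul_le hT0') (Real.sqrt_nonneg P.lam)
    have h2 : 1 / ((T : ℝ) + 1) ^ 2 ≤ 1 / (T : ℝ) - 1 / ((T : ℝ) + 1) := by
      rw [div_sub_div _ _ hT0'.ne' (by positivity), div_le_div_iff₀ (by positivity) (by positivity)]
      nlinarith
    rw [one_div ((T : ℝ) + 1)] at *
    linarith

end Setup

end ParallelGreedy

/-! ### From the algorithm to the fractional cut, and the choice of parameters. -/

namespace ParallelGreedy

theorem sum_eq_sum_castLE {k T : ℕ} (hk : k ≤ T) (G : Fin T → ℝ)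
    (h : ∀ ℓ : Fin T, k ≤ (ℓ : ℕ) → G ℓ = 0) : ∑ ℓ, G ℓ = ∑ ℓ : Fin k, G (Fin.castLE hk ℓ) := by
  obtain ⟨m, rfl⟩ := Nat.exists_eq_add_of_le hk
  rw [Fin.sum_univ_add, Finset.sum_eq_zero (s := Finset.univ (α := Fin m)), add_zero]
  · rfl
  · intro ℓ _
    exact h _ (by simp)

theorem actWeight_castLE {k T : ℕ} (hk : k ≤ T) (v : ℝ) (a : Fin T → Bool) (ℓ : Fin k) :
    actWeight v (fun s => a (Fin.castLE hk s)) ℓ = actWeight v a (Fin.castLE hk ℓ) := by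
  have : (∀ s : Fin k, s < ℓ → a (Fin.castLE hk s) = false) ↔
      ∀ s : Fin T, s < Fin.castLE hk ℓ → a s = false := by
    constructor
    · intro h s hs
      exact h ⟨s, lt_trans hs ℓ.2⟩ hs
    · intro h s hs
      exact h _ hs
  simp only [actWeight, this]
  rfl

/-- The seed that puts the points of `S^{t₀}` on the sides given by `s`. -/
def seedOf {n T : ℕ} (A : Fin n → Fin T → Bool) (t₀ : ℕ) (s : Fin n → Fin 2) : Seed A t₀ :=
  fun k => s ((seedSet A t₀).orderIsoOfFin rfl k)

theorem seedOf_seedIndex {n T : ℕ} (A : Fin n → Fin T → Bool) (t₀ : ℕ) (s : Fin n → Fin 2)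
    (i : Fin n) (hi : i ∈ seedSet A t₀) : seedOf A t₀ s (seedIndex A t₀ i hi) = s i := by
  simp [seedOf, seedIndex]

namespace Setup

variable {n T : ℕ} (P : Setup n) {X : Type*} [MetricSpace X] {x : Fin n → X}

/-- The algorithm reads only activated points, on which the fractional cut is integral and frozen;
inactive points have load zero and drop out of the estimates. Induction on the number of columns
read. -/
theorem bit_assign_eq_frac (hd : ∀ i j, P.d i j = dist (x i) (x j)) (A K : Fin n → Fin T → Bool)
    (k : ℕ) (hk : k ≤ T) (i : Fin n) (h : ∃ ℓ, A i ℓ = true) (hi : actTime (A i) h ≤ k)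
    (b : Fin 2) :
    bit (assign x P.w P.t₀ P.γ A K (seedOf A P.t₀ P.s) i h b) =
      P.frac k (fun j ℓ => A j (Fin.castLE hk ℓ)) (fun j ℓ => K j (Fin.castLE hk ℓ)) i b := by
  induction k generalizing i b with
  | zero => exact absurd hi (by simp [actTime, time])
  | succ k ih =>
    have hk' : k ≤ T := Nat.le_of_succ_le hk
    obtain ⟨ℓ₀, hℓ₀, hA⟩ := exists_time_eq_actTime (A i) h
    have hfrac : P.frac (k + 1) (fun j ℓ => A j (Fin.castLE hk ℓ))
        (fun j ℓ => K j (Fin.castLE hk ℓ)) i b =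
      if ∀ ℓ : Fin k, A i (Fin.castLE hk' ℓ) = false then
        if A i (Fin.castLE hk (Fin.last k)) = true then
          P.target (fun j ℓ => A j (Fin.castLE hk' ℓ)) (fun j ℓ => K j (Fin.castLE hk' ℓ)) i b
        else mix k (nextWeight (P.w i) (fun ℓ => A i (Fin.castLE hk' ℓ)))
          (P.frac k (fun j ℓ => A j (Fin.castLE hk' ℓ)) (fun j ℓ => K j (Fin.castLE hk' ℓ)) i b)
          (P.target (fun j ℓ => A j (Fin.castLE hk' ℓ)) (fun j ℓ => K j (Fin.castLE hk' ℓ)) i b)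
      else P.frac k (fun j ℓ => A j (Fin.castLE hk' ℓ)) (fun j ℓ => K j (Fin.castLE hk' ℓ)) i b :=
      rfl
    rw [hfrac]
    -- Either the point activates exactly in the new column, and its estimates use times at most
    -- `k`, or it was activated earlier and is frozen.
    rcases Nat.lt_or_ge k (actTime (A i) h) with hlt | hle
    · have hact : actTime (A i) h = k + 1 := by omega
      have hbefore : ∀ ℓ : Fin k, A i (Fin.castLE hk' ℓ) = false := by
        intro ℓ
        by_contra hne
        have := actTime_le (a := A i) (ℓ := Fin.castLE hk' ℓ) (by simpa using hne)
        simp only [time, Fin.val_castLE] at this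
        omega
      have hlast : A i (Fin.castLE hk (Fin.last k)) = true := by
        have : Fin.castLE hk (Fin.last k) = ℓ₀ := by
          ext
          simp only [time] at hℓ₀
          simp only [Fin.val_castLE, Fin.val_last]
          omega
        rw [this, hA]
      rw [if_pos hbefore, if_pos hlast, assign, target, choice]
      by_cases ht : actTime (A i) h ≤ P.t₀
      · rw [dif_pos ht, if_pos (hact ▸ ht), seedOf_seedIndex]
        rfl
      · rw [dif_neg ht, if_neg (show ¬ k + 1 ≤ P.t₀ from hact ▸ ht)]
        have hC : (fun c => ∑ p : Fin n × Fin T,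
            if hp : p ∈ summary A K ∧ time p.2 < actTime (A i) h then
              dist (x i) (x p.1) / (actWeight (P.w p.1) (A p.1) p.2 *
                keepProb P.t₀ P.γ (time p.2)) *
              bit (assign x P.w P.t₀ P.γ A K (seedOf A P.t₀ P.s) p.1
                ⟨p.2, (Finset.mem_filter.1 hp.1).2.1⟩ c)
            else 0) =
            fun c => ∑ j, P.d i j *
              (P.load (fun j ℓ => A j (Fin.castLE hk' ℓ)) (fun j ℓ => K j (Fin.castLE hk' ℓ)) j *
              P.frac k (fun j ℓ => A j (Fin.castLE hk' ℓ))
                (fun j ℓ => K j (Fin.castLE hk' ℓ)) j c) := by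
          funext c
          rw [Fintype.sum_prod_type]
          refine Finset.sum_congr rfl fun j _ => ?_
          rw [sum_eq_sum_castLE hk', load, Finset.sum_mul, Finset.mul_sum]
          · refine Finset.sum_congr rfl fun ℓ _ => ?_
            have htime : time (Fin.castLE hk' ℓ) ≤ k := ℓ.2
            by_cases hp : A j (Fin.castLE hk' ℓ) = true ∧ K j (Fin.castLE hk' ℓ) = true
            · rw [dif_pos ⟨by simpa [summary] using hp, lt_of_le_of_lt htime hlt⟩, if_pos hp,
                ih hk' j _ ((actTime_le hp.1).trans htime), hd, actWeight_castLE, div_eq_mul_inv,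
                mul_assoc]
              rfl
            · rw [dif_neg (fun h => hp (by simpa [summary] using h.1)), if_neg hp]
              ring
          · intro ℓ hℓ
            rw [dif_neg]
            rintro ⟨-, h2⟩
            simp only [time] at h2
            omega
        rw [← hC]
        unfold greedySide
        split_ifs <;> rfl
    · rw [if_neg]
      · exact ih hk' i h hle b
      · intro hall
        have hlt : (ℓ₀ : ℕ) < k := by
          simp only [time] at hℓ₀
          omega
        have := hall ⟨ℓ₀, hlt⟩
        rw [show Fin.castLE hk' ⟨ℓ₀, hlt⟩ = ℓ₀ from rfl, hA] at this
        exact Bool.noConfusion this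

theorem internal_outputCut_le (hd : ∀ i j, P.d i j = dist (x i) (x j))
    (A K : Fin n → Fin T → Bool) :
    internal x (outputCut x P.w P.t₀ P.γ A K (seedOf A P.t₀ P.s)) ≤
      P.cost (P.frac T A K) + ∑ i, inactive (A i) * P.D i := by
  set y : Fin n → Fin 2 → ℝ := fun i b =>
    bit (outputCut x P.w P.t₀ P.γ A K (seedOf A P.t₀ P.s) i b) with hy
  set z := P.frac T A K with hz
  have hact : ∀ i, inactive (A i) = 0 ∧ y i = z i ∨ inactive (A i) = 1 ∧ y i = sideVec 0 := by
    intro i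
    by_cases h : ∃ ℓ, A i ℓ = true
    · left
      refine ⟨if_neg ?_, ?_⟩
      · obtain ⟨ℓ, hℓ⟩ := h
        exact fun h' => by simp [h' ℓ] at hℓ
      · funext b
        obtain ⟨ℓ, hℓ, -⟩ := exists_time_eq_actTime (A i) h
        have := P.bit_assign_eq_frac hd A K T le_rfl i h (hℓ ▸ ℓ.2) b
        simp only [hy, outputCut, dif_pos h, this]
        rfl
    · right
      refine ⟨if_pos (by simpa using h), ?_⟩
      funext b
      simp only [hy, outputCut, dif_neg h]
      rfl
  have hz1 : ∀ i, (∀ b, 0 ≤ z i b) ∧ z i 0 + z i 1 = 1 := P.frac_mem A K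
  have hy1 : ∀ i, (∀ b, 0 ≤ y i b) ∧ y i 0 + y i 1 = 1 := fun i => by
    rcases hact i with h | h <;> rw [h.2]
    · exact hz1 i
    · exact ⟨sideVec_nonneg 0, sideVec_sum 0⟩
  -- Rows differ only at inactive points, and a product of two rows lies in `[0,1]`; a pair can thus
  -- lose at most 1, and only if one of its points is inactive.
  have hpt : ∀ i j, y i 0 * y j 0 + y i 1 * y j 1 ≤
      z i 0 * z j 0 + z i 1 * z j 1 + (inactive (A i) + inactive (A j)) := by
    intro i j
    have h1 : y i 0 * y j 0 + y i 1 * y j 1 ≤ 1 := by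
      have a0 := mul_le_of_le_one_right ((hy1 i).1 0)
        (show y j 0 ≤ 1 by linarith [(hy1 j).1 1, (hy1 j).2])
      have a1 := mul_le_of_le_one_right ((hy1 i).1 1)
        (show y j 1 ≤ 1 by linarith [(hy1 j).1 0, (hy1 j).2])
      linarith [(hy1 i).2]
    have h2 : 0 ≤ z i 0 * z j 0 + z i 1 * z j 1 :=
      add_nonneg (mul_nonneg ((hz1 i).1 0) ((hz1 j).1 0))
        (mul_nonneg ((hz1 i).1 1) ((hz1 j).1 1))
    have hi := inactive_nonneg (A i)
    have hj := inactive_nonneg (A j)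
    rcases hact i with h | h
    · rcases hact j with h' | h'
      · rw [h.2, h'.2, h.1, h'.1]
        linarith
      · linarith [h'.1]
    · linarith [h.1]
  have hsum : ∑ i, inactive (A i) * P.D i =
      (1 / 2 : ℝ) * ∑ i, ∑ j, P.d i j * (inactive (A i) + inactive (A j)) := by
    have e1 : ∑ i, ∑ j, P.d i j * inactive (A i) = ∑ i, inactive (A i) * P.D i := by
      refine Finset.sum_congr rfl fun i _ => ?_
      rw [D, Finset.mul_sum]
      exact Finset.sum_congr rfl fun j _ => mul_comm _ _
    have e2 : ∑ i, ∑ j, P.d i j * inactive (A j) = ∑ i, inactive (A i) * P.D i := by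
      rw [← e1, Finset.sum_comm]
      exact Finset.sum_congr rfl fun i _ => Finset.sum_congr rfl fun j _ => by rw [P.d_symm]
    simp only [mul_add, Finset.sum_add_distrib, e1, e2]
    ring
  rw [hsum, cost, ← mul_add, ← Finset.sum_add_distrib]
  refine mul_le_mul_of_nonneg_left (Finset.sum_le_sum fun i _ => ?_) (by norm_num)
  rw [← Finset.sum_add_distrib]
  refine Finset.sum_le_sum fun j _ => ?_
  rw [← hd, ← mul_add]
  exact mul_le_mul_of_nonneg_left (hpt i j) (P.d_nonneg i j)

theorem expect_inactive_mul_D_le (hT : 0 < T) :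
    expect P.w P.t₀ P.γ (fun (A _ : Fin n → Fin T → Bool) => ∑ i, inactive (A i) * P.D i) ≤
      n * P.lam / T * ∑ i, P.D i := by
  have hT' : (0 : ℝ) < T := by exact_mod_cast hT
  rw [expect_sum, div_mul_eq_mul_div, le_div_iff₀ hT', Finset.sum_mul]
  calc _ ≤ ∑ i, P.D i * (P.w i)⁻¹ := by
        refine Finset.sum_le_sum fun i _ => ?_
        have h := mul_le_mul_of_nonneg_left
          (expect_inactive_le (T := T) (t₀ := P.t₀) P.w_mem P.one_le_γ i) (P.D_nonneg i)
        simp only [mul_comm _ (P.D i), expect_const_mul]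
        linarith
    -- Symmetry moves the inverse weight to the second index, where compatibility applies.
    _ = ∑ i, ∑ j, P.d i j / P.w j := by
        rw [Finset.sum_comm]
        refine Finset.sum_congr rfl fun i _ => ?_
        rw [D, Finset.sum_mul]
        exact Finset.sum_congr rfl fun j _ => by rw [P.d_symm, div_eq_mul_inv]
    _ ≤ ∑ i, ∑ _j : Fin n, P.lam * P.D i :=
        Finset.sum_le_sum fun i _ => Finset.sum_le_sum fun j _ => P.compatible i j
    _ = n * P.lam * ∑ i, P.D i := by
        simp only [Finset.sum_const, Finset.card_univ, Fintype.card_fin, nsmul_eq_mul,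
          Finset.mul_sum]
        exact Finset.sum_congr rfl fun i _ => by ring

theorem expect_minValue_le (hd : ∀ i j, P.d i j = dist (x i) (x j)) {ε : ℝ} (hε : 0 < ε)
    (hlam : 0 < P.lam) (hT : 0 < T) (hTe : (n : ℝ) * P.lam / ε ≤ T)
    (hγ : (Real.log T + 1) ^ 2 * P.lam / ε ^ 2 ≤ P.γ)
    (ht₀ : max (√(P.γ * P.lam) / ε) (1 / ε) ≤ (P.t₀ : ℝ)) :
    expect P.w P.t₀ P.γ (fun (A K : Fin n → Fin T → Bool) =>
        minValue fun σ : Seed A P.t₀ => internal x (outputCut x P.w P.t₀ P.γ A K σ)) ≤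
      P.cost (fun i b => sideVec (P.s i) b) + 26 * ε * ∑ i, P.D i := by
  have hT' : (0 : ℝ) < T := by exact_mod_cast hT
  have hD : 0 ≤ ∑ i, P.D i := Finset.sum_nonneg fun i _ => P.D_nonneg i
  have hγ0 : 0 < P.γ := lt_of_lt_of_le one_pos P.one_le_γ
  have ht1 : 1 / ε ≤ P.t₀ := (le_max_right _ _).trans ht₀
  have ht2 : √(P.γ * P.lam) / ε ≤ P.t₀ := (le_max_left _ _).trans ht₀
  have htpos : (0 : ℝ) < P.t₀ := lt_of_lt_of_le (by positivity) ht1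
  have hlog : 0 ≤ Real.log T := Real.log_nonneg (by exact_mod_cast hT)
  have hinact : n * P.lam / T ≤ ε := by
    rw [div_le_iff₀ hT']
    rw [div_le_iff₀ hε] at hTe
    linarith
  have hε2 : P.lam * (Real.log T + 1) ^ 2 ≤ ε ^ 2 * P.γ := by
    rw [div_le_iff₀ (by positivity)] at hγ
    linarith
  have hlamγ : √(P.lam / P.γ) * (Real.log T + 1) ≤ ε := by
    refine abs_le_of_sq_le_sq' ?_ hε.le |>.2
    rw [mul_pow, Real.sq_sqrt (by positivity), div_mul_eq_mul_div, div_le_iff₀ hγ0]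
    exact hε2
  -- From `lam ≤ ε² γ` follows `lam / ε ≤ √(γ lam) ≤ ε t₀`, that is, `lam ≤ ε² t₀`.
  have hlamt : √P.lam * (1 / √P.t₀) ≤ ε := by
    have h1 : P.lam ≤ ε ^ 2 * P.γ :=
      (le_mul_of_one_le_right hlam.le (one_le_pow₀ (by linarith))).trans hε2
    have h2 : P.lam / ε ≤ √(P.γ * P.lam) := by
      refine Real.le_sqrt_of_sq_le ?_
      rw [div_pow, div_le_iff₀ (by positivity)]
      nlinarith
    have h3 : P.lam / ε ≤ P.t₀ * ε := h2.trans ((div_le_iff₀ hε).1 ht2)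
    rw [div_le_iff₀ hε] at h3
    rw [mul_one_div, div_le_iff₀ (Real.sqrt_pos.2 htpos), Real.sqrt_le_left (by positivity),
      mul_pow, Real.sq_sqrt htpos.le]
    linarith
  have ht3 : 1 / (P.t₀ : ℝ) ≤ ε := (one_div_le hε htpos).1 ht1
  have hcost : expect P.w P.t₀ P.γ
      (fun (A K : Fin n → Fin T → Bool) => P.cost (P.frac T A K)) ≤
      P.cost (fun i b => sideVec (P.s i) b) + 25 * ε * ∑ i, P.D i := by
    rcases le_total T P.t₀ with h | h
    · rw [P.expect_cost_eq_of_le h]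
      have : 0 ≤ 25 * ε * ∑ i, P.D i := by positivity
      linarith
    -- The three error terms contribute 16, 8 and 1 times `ε`; never-activated points later bring
    -- the total to 26.
    · refine (P.expect_cost_le hlam.le (by exact_mod_cast htpos) h).trans ?_
      refine add_le_add le_rfl (mul_le_mul_of_nonneg_right ?_ hD)
      have h1 : 0 ≤ √P.lam * (1 / √T) := by positivity
      have h2 : 0 ≤ 1 / (T : ℝ) := by positivity
      have h3 := mul_le_mul_of_nonneg_left (harmonic_le_one_add_log T)
        (Real.sqrt_nonneg (P.lam / P.γ))
      linarith
  have hmin : ∀ A K : Fin n → Fin T → Bool,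
      (minValue fun σ : Seed A P.t₀ => internal x (outputCut x P.w P.t₀ P.γ A K σ)) ≤
        P.cost (P.frac T A K) + ∑ i, inactive (A i) * P.D i := fun A K =>
    (Finset.inf'_le _ (Finset.mem_univ (seedOf A P.t₀ P.s))).trans
      (P.internal_outputCut_le hd A K)
  refine (expect_mono P.w_mem P.one_le_γ hmin).trans ?_
  rw [expect_add]
  have h1 := P.expect_inactive_mul_D_le hT
  have h2 := mul_le_mul_of_nonneg_right hinact hD
  linarith

end Setup

theorem bit_nonneg (b : Bool) : 0 ≤ bit b := by
  unfold bit
  split_ifs <;> norm_num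

/-- A 0/1 matrix without zero rows costs at least as much as a cut contained in it. -/
theorem exists_cut_le {n : ℕ} {X : Type*} [MetricSpace X] (x : Fin n → X) (z : FullCut n) :
    ∃ s : Fin n → Fin 2, (1 / 2 : ℝ) * ∑ i, ∑ j, dist (x i) (x j) *
      (sideVec (s i) 0 * sideVec (s j) 0 + sideVec (s i) 1 * sideVec (s j) 1) ≤
        internal x z.1 := by
  have hex : ∀ i, ∃ b, z.1 i b = true := by
    intro i
    by_contra h
    push Not at h
    exact z.2 i (funext fun b => by simpa using h b)
  choose s hs using hex
  have hle : ∀ i b, sideVec (s i) b ≤ bit (z.1 i b) := by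
    intro i b
    by_cases h : b = s i
    · rw [h, hs]
      simp [sideVec, sideRow]
    · refine le_trans (le_of_eq ?_) (bit_nonneg _)
      simp [sideVec, sideRow, h, bit]
  refine ⟨s, mul_le_mul_of_nonneg_left (Finset.sum_le_sum fun i _ => Finset.sum_le_sum fun j _ =>
    mul_le_mul_of_nonneg_left (add_le_add ?_ ?_) dist_nonneg) (by norm_num)⟩ <;>
  exact mul_le_mul (hle _ _) (hle _ _) (sideVec_nonneg _ _) (bit_nonneg _)

theorem internal_eq_zero {n : ℕ} {X : Type*} [MetricSpace X] {x : Fin n → X}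
    (h : ∀ i j, dist (x i) (x j) = 0) (z : Cut n) : internal x z = 0 := by
  simp [internal, h]

end ParallelGreedy

theorem theorem2p5 :
    ∃ C : ℝ, 0 < C ∧
      ∀ {X : Type*} [MetricSpace X] (n : ℕ) (x : Fin n → X) (w : Fin n → ℝ)
        (lam ε γ : ℝ) (te t₀ : ℕ),
        (∀ i, 0 < w i ∧ w i ≤ 1 / 2) →
        ParallelGreedy.Compatible x w lam →
        0 < ε →
        1 ≤ γ →
        (n : ℝ) * lam / ε ≤ (te : ℝ) →
        (Real.log te + 1) ^ 2 * lam / ε ^ 2 ≤ γ →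
        max (Real.sqrt (γ * lam) / ε) (1 / ε) ≤ (t₀ : ℝ) →
        ParallelGreedy.expect (n := n) (T := te) w t₀ γ (fun A K =>
            ParallelGreedy.minValue fun σ : ParallelGreedy.Seed A t₀ =>
              ParallelGreedy.internal x (ParallelGreedy.outputCut x w t₀ γ A K σ))
          ≤ ParallelGreedy.minValue (fun z : ParallelGreedy.FullCut n =>
                ParallelGreedy.internal x z.1)
            + C * ε * ∑ i, ∑ j, dist (x i) (x j) := by
  refine ⟨26, by norm_num, ?_⟩
  intro X _ n x w lam ε γ te t₀ hw hcomp hε hγ1 hte hγ ht₀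
  rw [← sub_le_iff_le_add]
  refine Finset.le_inf' _ _ fun z _ => ?_
  rw [sub_le_iff_le_add]
  -- If all distances vanish, everything is zero, while `lam` may be nonpositive and `te` zero. A
  -- positive distance forces `lam` and `te` to be positive.
  by_cases hzero : ∀ i j, dist (x i) (x j) = 0
  · simp [ParallelGreedy.internal_eq_zero hzero, hzero, ParallelGreedy.minValue,
      ParallelGreedy.expect_const]
  · push Not at hzero
    obtain ⟨i₀, j₀, hne⟩ := hzero
    have hpos : 0 < dist (x i₀) (x j₀) := lt_of_le_of_ne dist_nonneg hne.symm
    have hlam : 0 < lam := by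
      have h1 := lt_of_lt_of_le (div_pos hpos (hw j₀).1) (hcomp i₀ j₀)
      exact pos_of_mul_pos_left h1 (Finset.sum_nonneg fun _ _ => dist_nonneg)
    have hn : (0 : ℝ) < n := by exact_mod_cast i₀.pos
    have hte0 : 0 < te := by
      have : (0 : ℝ) < te := lt_of_lt_of_le (by positivity) hte
      exact_mod_cast this
    obtain ⟨s, hs⟩ := ParallelGreedy.exists_cut_le x z
    let P : ParallelGreedy.Setup n :=
      { d := fun i j => dist (x i) (x j), w := w, s := s, lam := lam, γ := γ, t₀ := t₀
        d_nonneg := fun _ _ => dist_nonneg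
        d_symm := fun _ _ => dist_comm _ _
        d_self := fun _ => dist_self _
        w_mem := hw
        one_le_γ := hγ1
        compatible := hcomp }
    exact (P.expect_minValue_le (x := x) (fun _ _ => rfl) hε hlam hte0 hte hγ ht₀).trans
      (add_le_add hs le_rfl)
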